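/- Let $X$ be a (real or complex) Hilbert space and let $A:D(A)\subset X\to X$ be the infinitesimal generator of an analytic $C_0$-semigroup $\{S(t);t\ge 0\}$ on $X$ (if $X$ is real, analyticity means that the complexified semigroup extends to an analytic semigroup on a sector). Endow $D(A)$ with the graph norm $\|x\|_{D(A)}=\|x\|_X+\|Ax\|_X$. Let $T>0$, let $E\subset(0,T)$ be a Lebesgue measurable set of positive measure, and let $d,k>0$ and $b\in\mathbb R$. Then there is a constant $C>0$, depending only on $E,T,d,k,b$ and on the semigroup $S$ (that is, on $X$ and $A$), with the following property. Let $U$ be a Hilbert space over the same field and let $B\in\mathcal L(D(A),U)$ with $\|B\|_{\mathcal L(D(A),U)}\le b$ be such that (a) $B$ is an admissible observation operator for $S$: for each $\tau>0$ there is $C(\tau)>0$ with $$\int_0^\tau\|BS(t)u_0\|_U^2\,dt\le C(\tau)\|u_0\|_X^2\quad\text{for all }u_0\in D(A);$$ (b) for every $L\in(0,1]$, $$\|S(L)u_0\|_X^2\le e^{d/L^k}\int_0^L\|BS(t)u_0\|_U^2\,dt\quad\text{for all }u_0\in D(A).$$ Then $$\|S(T)u_0\|_X\le C\int_E\|BS(t)u_0\|_U\,dt\quad\text{for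 all }u_0\in D(A).$$ -/

import Mathlib

open Set Filter Topology MeasureTheory

universe u v w

/-- `S`, restricted to times `t ≥ 0`, is a `C₀` (strongly continuous) semigroup of bounded linear
operators on `X`. Values of `S` at negative times are irrelevant. -/
structure IsC0Semigroup {𝕜 : Type v} [RCLike 𝕜] {X : Type u} [NormedAddCommGroup X]
    [InnerProductSpace 𝕜 X] (S : ℝ → X →L[𝕜] X) : Prop where
  map_zero : S 0 = ContinuousLinearMap.id 𝕜 X
  map_add : ∀ s t : ℝ, 0 ≤ s → 0 ≤ t → S (s + t) = (S s).comp (S t)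
  tendsto_zero : ∀ x : X, Tendsto (fun t : ℝ => S t x) (𝓝[>] 0) (𝓝 x)

/-- The (in general unbounded) operator `A`, with domain `D(A) = A.domain`, is the infinitesimal
generator of `S`: one has `x ∈ D(A)` and `A x = y` if and only if
`(S(h) x - x) / h` tends to `y` as `h → 0+`. -/
def IsInfinitesimalGenerator {𝕜 : Type v} [RCLike 𝕜] {X : Type u} [NormedAddCommGroup X]
    [InnerProductSpace 𝕜 X] (A : X →ₗ.[𝕜] X) (S : ℝ → X →L[𝕜] X) : Prop :=
  ∀ x y : X, (x, y) ∈ A.graph ↔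
    Tendsto (fun h : ℝ => ((h⁻¹ : ℝ) : 𝕜) • (S h x - x)) (𝓝[>] 0) (𝓝 y)

/-- The open sector `{z ≠ 0 : |arg z| < θ}`. -/
def openSector (θ : ℝ) : Set ℂ := {z : ℂ | z ≠ 0 ∧ |z.arg| < θ}

/-- `T` is an analytic semigroup of bounded operators on the open sector of half-angle `θ`
in the complex Hilbert space `Y`: it is holomorphic there for the operator norm, satisfies the
semigroup law, and tends strongly to the identity at the vertex of the sector. -/
structure IsSectorSemigroup {Y : Type u} [NormedAddCommGroup Y] [InnerProductSpace ℂ Y]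
    (θ : ℝ) (T : ℂ → Y →L[ℂ] Y) : Prop where
  pos : 0 < θ
  le_pi_div_two : θ ≤ Real.pi / 2
  differentiableOn : DifferentiableOn ℂ T (openSector θ)
  map_add : ∀ z ∈ openSector θ, ∀ z' ∈ openSector θ, T (z + z') = (T z).comp (T z')
  tendsto_zero : ∀ y : Y, Tendsto (fun z : ℂ => T z y) (𝓝[openSector θ] 0) (𝓝 y)

/-- The scalar of `𝕜` (which is `ℝ` or `ℂ`) as a complex number. -/
noncomputable def scalarToComplex {𝕜 : Type v} [RCLike 𝕜] (c : 𝕜) : ℂ :=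
  (RCLike.re c : ℂ) + (RCLike.im c : ℂ) * Complex.I

/-- `j : X → Y` exhibits the complex Hilbert space `Y` as the complexification of the Hilbert
space `X` over `𝕜`: it is `𝕜`-linear, preserves inner products, and `Y = j(X) + i j(X)`.
For `𝕜 = ℝ` these properties say that `(a, b) ↦ j a + i j b` identifies the usual
complexification `X ⊕ i X`, with `‖a + i b‖² = ‖a‖² + ‖b‖²`, with `Y`. For `𝕜 = ℂ` they say that
`j` is a unitary isomorphism from `X` onto `Y`, so that `Y` is just `X`. -/
structure IsComplexification (𝕜 : Type v) [RCLike 𝕜] {X Y : Type u} [NormedAddCommGroup X]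
    [InnerProductSpace 𝕜 X] [NormedAddCommGroup Y] [InnerProductSpace ℂ Y]
    (j : X →+ Y) : Prop where
  map_smul : ∀ (c : 𝕜) (x : X), j (c • x) = scalarToComplex c • j x
  inner_map : ∀ x x' : X, inner ℂ (j x) (j x') = scalarToComplex (inner 𝕜 x x')
  span : ∀ y : Y, ∃ a b : X, y = j a + Complex.I • j b

/-- The semigroup `S` on the real or complex Hilbert space `X` is analytic: it (for `𝕜 = ℝ`, its
complexification) extends to an analytic semigroup on some open sector around `(0, ∞)`. -/
def IsAnalyticSemigroup {𝕜 : Type v} [RCLike 𝕜] {X : Type u} [NormedAddCommGroup X]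
    [InnerProductSpace 𝕜 X] (S : ℝ → X →L[𝕜] X) : Prop :=
  ∃ (Y : Type u) (_ : NormedAddCommGroup Y) (_ : InnerProductSpace ℂ Y) (_ : CompleteSpace Y)
    (j : X →+ Y) (θ : ℝ) (T : ℂ → Y →L[ℂ] Y),
    IsComplexification 𝕜 j ∧ IsSectorSemigroup θ T ∧
      ∀ t : ℝ, 0 < t → ∀ x : X, T (t : ℂ) (j x) = j (S t x)

/-- For a complex Hilbert space the definition is the usual one. -/
theorem isAnalyticSemigroup_complex {X : Type u} [NormedAddCommGroup X]
    [InnerProductSpace ℂ X] [CompleteSpace X] {S : ℝ → X →L[ℂ] X} {θ : ℝ} {T : ℂ → X →L[ℂ] X}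
    (hT : IsSectorSemigroup θ T) (hTS : ∀ t : ℝ, 0 < t → T (t : ℂ) = S t) :
    IsAnalyticSemigroup S := by
  refine ⟨X, inferInstance, inferInstance, inferInstance, AddMonoidHom.id X, θ, T,
    ⟨?_, ?_, ?_⟩, hT, fun t ht x => by simp [hTS t ht]⟩
  · intro c x
    simp [scalarToComplex, Complex.re_add_im]
  · intro x x'
    simp [scalarToComplex, Complex.re_add_im]
  · intro y
    exact ⟨y, 0, by simp⟩

/-- The graph norm of `D(A)`. -/
noncomputable def graphNorm {𝕜 : Type v} [RCLike 𝕜] {X : Type u} [NormedAddCommGroup X]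
    [InnerProductSpace 𝕜 X] (A : X →ₗ.[𝕜] X) (x : A.domain) : ℝ :=
  ‖(x : X)‖ + ‖A x‖

/-- `B ∈ L(D(A), U)` with `‖B‖_{L(D(A), U)} ≤ b`, where `D(A)` carries the graph norm. -/
def ObservationBoundedBy {𝕜 : Type v} [RCLike 𝕜] {X : Type u} [NormedAddCommGroup X]
    [InnerProductSpace 𝕜 X] {U : Type w} [NormedAddCommGroup U] [InnerProductSpace 𝕜 U]
    {A : X →ₗ.[𝕜] X} (B : A.domain →ₗ[𝕜] U) (b : ℝ) : Prop :=
  ∀ x : A.domain, ‖B x‖ ≤ b * graphNorm A x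

/-- A `C₀` semigroup leaves the domain of its generator invariant. -/
theorem IsC0Semigroup.map_mem_domain {𝕜 : Type v} [RCLike 𝕜] {X : Type u}
    [NormedAddCommGroup X] [InnerProductSpace 𝕜 X] {S : ℝ → X →L[𝕜] X} {A : X →ₗ.[𝕜] X}
    (hS : IsC0Semigroup S) (hA : IsInfinitesimalGenerator A S) {t : ℝ} (ht : 0 ≤ t)
    (x : A.domain) : S t x ∈ A.domain := by
  have h1 := (hA x (A x)).1 (A.mem_graph x)
  have h2 : Tendsto (fun h : ℝ => ((h⁻¹ : ℝ) : 𝕜) • (S h (S t x) - S t x)) (𝓝[>] 0)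
      (𝓝 (S t (A x))) := by
    refine (((S t).continuous.tendsto (A x)).comp h1).congr' ?_
    filter_upwards [self_mem_nhdsWithin] with h hh
    have e : S h (S t x) = S t (S h x) := by
      have e1 := hS.map_add h t (le_of_lt hh) ht
      have e2 := hS.map_add t h ht (le_of_lt hh)
      rw [add_comm, e2] at e1
      simpa using (DFunLike.congr_fun e1 (x : X)).symm
    simp [e, map_sub]
  exact A.mem_domain_of_mem_graph ((hA _ _).2 h2)

open Classical in
/-- The observation `t ↦ B S(t) u₀ ∈ U`. It is set to `0` where `S(t) u₀ ∉ D(A)`, which does not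
happen for `t ≥ 0` and `u₀ ∈ D(A)`, by `IsC0Semigroup.map_mem_domain`. -/
noncomputable def observe {𝕜 : Type v} [RCLike 𝕜] {X : Type u} [NormedAddCommGroup X]
    [InnerProductSpace 𝕜 X] {U : Type w} [NormedAddCommGroup U] [InnerProductSpace 𝕜 U]
    {A : X →ₗ.[𝕜] X} (S : ℝ → X →L[𝕜] X) (B : A.domain →ₗ[𝕜] U) (u₀ : A.domain) (t : ℝ) : U :=
  if h : S t u₀ ∈ A.domain then B ⟨S t u₀, h⟩ else 0

/-- `B` is an admissible observation operator for `S`: for each `τ > 0` there is `C(τ) > 0` with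
`∫₀^τ ‖B S(t) u₀‖² dt ≤ C(τ) ‖u₀‖²` for all `u₀ ∈ D(A)`. (For `u₀ ∈ D(A)` the integrand is
continuous on `[0, τ]`.) -/
def IsAdmissibleObservation {𝕜 : Type v} [RCLike 𝕜] {X : Type u} [NormedAddCommGroup X]
    [InnerProductSpace 𝕜 X] {U : Type w} [NormedAddCommGroup U] [InnerProductSpace 𝕜 U]
    {A : X →ₗ.[𝕜] X} (S : ℝ → X →L[𝕜] X) (B : A.domain →ₗ[𝕜] U) : Prop :=
  ∀ τ : ℝ, 0 < τ → ∃ C : ℝ, 0 < C ∧ ∀ u₀ : A.domain,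
    ∫ t in (0 : ℝ)..τ, ‖observe S B u₀ t‖ ^ 2 ≤ C * ‖(u₀ : X)‖ ^ 2

/-- The observability inequality from time intervals with constants `d` and `k`. -/
def IntervalObservability {𝕜 : Type v} [RCLike 𝕜] {X : Type u} [NormedAddCommGroup X]
    [InnerProductSpace 𝕜 X] {U : Type w} [NormedAddCommGroup U] [InnerProductSpace 𝕜 U]
    {A : X →ₗ.[𝕜] X} (S : ℝ → X →L[𝕜] X) (B : A.domain →ₗ[𝕜] U) (d k : ℝ) : Prop :=
  ∀ L : ℝ, 0 < L → L ≤ 1 → ∀ u₀ : A.domain,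
    ‖S L u₀‖ ^ 2 ≤ Real.exp (d / L ^ k) * ∫ t in (0 : ℝ)..L, ‖observe S B u₀ t‖ ^ 2

/-!
The observation is controlled on short intervals `[L - κ L, L]` by its integral over any subset of
half measure: interpolate it at `n + 1` well-separated points of the subset where it is at most a
multiple of its mean. The Lebesgue function of such nodes is at most `24 ^ (n + 1)`, and, since the
orbit extends holomorphically to a disc of radius comparable to `L`, the interpolation error is,
up to this factor and a multiple of `1 / L`, at most `(1 / 72) ^ (n + 1) ‖u₀‖`. With `n` of order
`1 / L ^ k`, the observability inequality on `[L - κ L, L]` becomes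
`‖S(L) u₀‖ ≤ exp (β / L ^ k) ∫ ‖B S(t) u₀‖ dt + exp (- 1 / L ^ k) ‖u₀‖`.

Apply this on `[p + r q ^ (m + 1), p + r q ^ m]`, where `p` is a density point of `E`. For
`q ^ k = β / (β + 1)` the factor of the remainder at scale `m` is exactly the ratio of the weights
`exp (- β / L ^ k)` at the scales `m` and `m + 1`, so that the inequalities telescope.
-/

/-! ### Lagrange interpolation at separated nodes -/

theorem exists_mem_lt_volume_inter_Ici {G : Set ℝ} (hG : BddBelow G) {s : ℝ} (hs : 0 ≤ s)
    {r : ENNReal} (hvol : r + ENNReal.ofReal s < volume G) :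
    ∃ x ∈ G, r < volume (G ∩ Ici (x + s)) := by
  have hne : G.Nonempty := nonempty_of_measure_ne_zero (μ := volume) (zero_le.trans_lt hvol).ne'
  obtain ⟨η, hη, hηG⟩ := ENNReal.lt_iff_exists_add_pos_lt.1 hvol
  obtain ⟨x, hxG, hx⟩ : ∃ x ∈ G, x < sInf G + η :=
    exists_lt_of_csInf_lt hne (lt_add_of_pos_right _ (NNReal.coe_pos.2 hη))
  refine ⟨x, hxG, ?_⟩
  by_contra! hle
  have hsub : G ⊆ Icc (sInf G) (x + s) ∪ (G ∩ Ici (x + s)) := fun y hy =>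
    (le_total y (x + s)).imp (fun h => ⟨csInf_le hG hy, h⟩) (fun h => ⟨hy, h⟩)
  refine hηG.not_ge ?_
  calc volume G ≤ volume (Icc (sInf G) (x + s)) + volume (G ∩ Ici (x + s)) :=
        (measure_mono hsub).trans (measure_union_le _ _)
    _ ≤ ENNReal.ofReal (s + η) + r := by
        rw [Real.volume_Icc]
        gcongr
        linarith
    _ = r + ENNReal.ofReal s + η := by
        rw [ENNReal.ofReal_add hs η.coe_nonneg, ENNReal.ofReal_coe_nnreal]
        ring

theorem exists_separated_points {s : ℝ} (hs : 0 ≤ s) (n : ℕ) {G : Set ℝ} (hG : BddBelow G)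
    (hvol : n * ENNReal.ofReal s < volume G) :
    ∃ t : ℕ → ℝ, (∀ i ≤ n, t i ∈ G) ∧ ∀ i, t i + s ≤ t (i + 1) := by
  induction n generalizing G with
  | zero =>
    obtain ⟨x, hx⟩ : G.Nonempty :=
      nonempty_of_measure_ne_zero (μ := volume) (zero_le.trans_lt hvol).ne'
    refine ⟨fun i => x + i * s, fun i hi => ?_, fun i => ?_⟩
    · simpa [Nat.le_zero.1 hi] using hx
    · push_cast
      linarith
  | succ n ih =>
    rw [Nat.cast_succ, add_one_mul] at hvol
    obtain ⟨x, hxG, hx⟩ := exists_mem_lt_volume_inter_Ici hG hs hvol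
    obtain ⟨t, htG, hgap⟩ := ih (hG.mono inter_subset_left) hx
    refine ⟨fun i => Nat.casesOn i x t, ?_, ?_⟩
    · rintro (_ | i) hi
      · exact hxG
      · exact (htG i (Nat.le_of_succ_le_succ hi)).1
    · rintro (_ | i)
      · exact (htG 0 n.zero_le).2
      · exact hgap i

theorem mul_abs_sub_le_abs_sub_of_gaps {s : ℝ} {t : ℕ → ℝ} (h : ∀ i, t i + s ≤ t (i + 1))
    (i j : ℕ) : s * |(i : ℝ) - j| ≤ |t i - t j| := by
  wlog hij : j ≤ i generalizing i j
  · rw [abs_sub_comm, abs_sub_comm (t i)]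
    exact this j i (le_of_not_ge hij)
  have hmono : Monotone fun i : ℕ => t i - s * i :=
    monotone_nat_of_le_succ fun m => by
      push_cast
      linarith [h m]
  rw [abs_of_nonneg (sub_nonneg.2 (Nat.cast_le.2 hij))]
  exact le_abs.2 (Or.inl (by linarith [hmono hij]))

theorem prod_erase_range_abs_sub {n i : ℕ} (hi : i ≤ n) :
    ∏ j ∈ (Finset.range (n + 1)).erase i, |(i : ℝ) - j| = i.factorial * (n - i).factorial := by
  induction n, hi using Nat.le_induction with
  | base =>
    rw [Finset.range_add_one, Finset.erase_insert Finset.notMem_range_self,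
      ← Finset.prod_range_reflect, ← Finset.prod_range_add_one_eq_factorial, Nat.sub_self,
      Nat.factorial_zero, Nat.cast_one, mul_one, Nat.cast_prod]
    refine Finset.prod_congr rfl fun j hj => ?_
    rw [Nat.sub_sub, add_comm 1 j, Nat.cast_sub (Finset.mem_range.1 hj), sub_sub_cancel,
      abs_of_nonneg (Nat.cast_nonneg _)]
  | succ n hin ih =>
    have hcast : (i : ℝ) ≤ n := Nat.cast_le.2 hin
    rw [Finset.range_add_one, Finset.erase_insert_of_ne (by omega), Finset.prod_insert (by simp),
      ih, Nat.sub_add_comm hin, Nat.factorial_succ, abs_sub_comm,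
      abs_of_nonneg (by push_cast; linarith)]
    push_cast [Nat.cast_sub hin]
    ring

theorem abs_eval_basis_le {s l x : ℝ} {t : ℕ → ℝ} {n i : ℕ} (hs : 0 < s)
    (hgap : ∀ i, t i + s ≤ t (i + 1)) (hx : ∀ j ≤ n, |x - t j| ≤ l) (hi : i ≤ n) :
    |(Lagrange.basis (Finset.range (n + 1)) t i).eval x| ≤
      (l / s) ^ n / n.factorial * n.choose i := by
  have hl : 0 ≤ l := (abs_nonneg _).trans (hx 0 n.zero_le)
  have hfactor : ∀ j ∈ (Finset.range (n + 1)).erase i,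
      |(Lagrange.basisDivisor (t i) (t j)).eval x| ≤ l / s / |(i : ℝ) - j| := by
    intro j hj
    obtain ⟨hji, hjn⟩ := Finset.mem_erase.1 hj
    have hpos : 0 < |(i : ℝ) - j| := abs_pos.2 (sub_ne_zero.2 (Nat.cast_injective.ne hji.symm))
    simp only [Lagrange.basisDivisor, Polynomial.eval_mul, Polynomial.eval_C, Polynomial.eval_sub,
      Polynomial.eval_X]
    rw [abs_mul, abs_inv, inv_mul_eq_div, div_div]
    exact div_le_div₀ hl (hx j (Finset.mem_range_succ_iff.1 hjn)) (by positivity)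
      (mul_abs_sub_le_abs_sub_of_gaps hgap i j)
  rw [Lagrange.basis, Polynomial.eval_prod, Finset.abs_prod]
  refine (Finset.prod_le_prod (fun _ _ => abs_nonneg _) hfactor).trans_eq ?_
  rw [Finset.prod_div_distrib, prod_erase_range_abs_sub hi, Finset.prod_const,
    Finset.card_erase_of_mem (Finset.mem_range_succ_iff.2 hi), Finset.card_range,
    Nat.succ_sub_one, Nat.cast_choose ℝ hi]
  have := n.factorial_ne_zero
  field_simp

/-- The Lebesgue function `x ↦ ∑ᵢ |ℓᵢ x|` of the Lagrange basis `ℓ` at the nodes `v i`, `i ∈ s`: the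
norm of interpolation at the nodes followed by evaluation at `x`, for the maximum norm of data. -/
noncomputable def lebesgueFunction {ι : Type*} [DecidableEq ι] (s : Finset ι) (v : ι → ℝ)
    (x : ℝ) : ℝ :=
  ∑ i ∈ s, |(Lagrange.basis s v i).eval x|

theorem lebesgueFunction_nonneg {ι : Type*} [DecidableEq ι] (s : Finset ι) (v : ι → ℝ) (x : ℝ) :
    0 ≤ lebesgueFunction s v x :=
  Finset.sum_nonneg fun _ _ => abs_nonneg _

theorem lebesgueFunction_le_of_gaps {s l x : ℝ} {t : ℕ → ℝ} {n : ℕ} (hs : 0 < s)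
    (hgap : ∀ i, t i + s ≤ t (i + 1)) (hx : ∀ j ≤ n, |x - t j| ≤ l) :
    lebesgueFunction (Finset.range (n + 1)) t x ≤ (2 * (l / s)) ^ n / n.factorial := by
  have hchoose : ∑ i ∈ Finset.range (n + 1), (n.choose i : ℝ) = 2 ^ n := by
    exact_mod_cast Nat.sum_range_choose n
  calc lebesgueFunction (Finset.range (n + 1)) t x
      ≤ ∑ i ∈ Finset.range (n + 1), (l / s) ^ n / n.factorial * n.choose i :=
        Finset.sum_le_sum fun i hi =>
          abs_eval_basis_le hs hgap hx (Finset.mem_range_succ_iff.1 hi)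
    _ = (2 * (l / s)) ^ n / n.factorial := by
        rw [← Finset.mul_sum, hchoose, mul_pow]
        ring

/-- The nodes are taken `l / (4 (n + 1))` apart, and `(8 (n + 1)) ^ n / n! ≤ 8 ^ n e ^ (n + 1)`. -/
theorem exists_nodes_lebesgueFunction_le {G : Set ℝ} {α l : ℝ} (hl : 0 < l)
    (hG : G ⊆ Icc α (α + l)) (hvol : ENNReal.ofReal (l / 4) ≤ volume G) (n : ℕ) :
    ∃ t : ℕ → ℝ, (∀ i ∈ Finset.range (n + 1), t i ∈ G) ∧ Function.Injective t ∧
      ∀ x ∈ Icc α (α + l), lebesgueFunction (Finset.range (n + 1)) t x ≤ 24 ^ (n + 1) := by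
  set s : ℝ := l / (4 * (n + 1)) with hs
  have hs0 : 0 < s := by positivity
  have hns : n * ENNReal.ofReal s < volume G := by
    rw [← ENNReal.ofReal_natCast, ← ENNReal.ofReal_mul n.cast_nonneg]
    refine lt_of_lt_of_le ((ENNReal.ofReal_lt_ofReal_iff (by positivity)).2 ?_) hvol
    rw [hs, mul_div_assoc', div_lt_div_iff₀ (by positivity) (by positivity)]
    linarith
  obtain ⟨t, htG, hgap⟩ := exists_separated_points hs0.le n (bddBelow_Icc.mono hG) hns
  refine ⟨t, fun i hi => htG i (Finset.mem_range_succ_iff.1 hi),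
    (strictMono_nat_of_lt_succ fun i => by linarith [hgap i]).injective, fun x hx => ?_⟩
  have hdist : ∀ j ≤ n, |x - t j| ≤ l := fun j hj => by
    simpa using abs_sub_le_of_le_of_le hx.1 hx.2 (hG (htG j hj)).1 (hG (htG j hj)).2
  have hexp := Real.pow_div_factorial_le_exp (x := (n : ℝ) + 1) (by positivity) n
  calc lebesgueFunction (Finset.range (n + 1)) t x
      ≤ (2 * (l / s)) ^ n / n.factorial := lebesgueFunction_le_of_gaps hs0 hgap hdist
    _ = 8 ^ n * (((n : ℝ) + 1) ^ n / n.factorial) := by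
        rw [hs, div_div_cancel₀ hl.ne', ← mul_assoc, mul_pow, mul_div_assoc]
        norm_num
    _ ≤ 8 ^ (n + 1) * Real.exp (n + 1) := by
        gcongr
        · norm_num
        · exact n.le_succ
    _ = (8 * Real.exp 1) ^ (n + 1) := by
        rw [mul_pow, ← Real.exp_nat_mul, mul_one, Nat.cast_succ]
    _ ≤ 24 ^ (n + 1) := by
        gcongr
        linarith [Real.exp_one_lt_three]

section LagrangeError

variable {ι : Type*} [DecidableEq ι] {s : Finset ι} {v : ι → ℝ} {x : ℝ}

/-- The error `f x - ∑ᵢ ℓᵢ x • f (v i)` at `x` of Lagrange interpolation of a vector-valued `f` at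
the nodes `v i`, `i ∈ s`. The weights `ℓᵢ x` are real; the field `𝕜` only says how they act. -/
noncomputable def lagrangeError (𝕜 : Type*) [RCLike 𝕜] {V : Type*} [AddCommGroup V] [Module 𝕜 V]
    (s : Finset ι) (v : ι → ℝ) (x : ℝ) (f : ℝ → V) : V :=
  f x - ∑ i ∈ s, (((Lagrange.basis s v i).eval x : ℝ) : 𝕜) • f (v i)

theorem lagrangeError_congr {𝕜 V : Type*} [RCLike 𝕜] [AddCommGroup V] [Module 𝕜 V] {f g : ℝ → V}
    (hx : f x = g x) (hv : ∀ i ∈ s, f (v i) = g (v i)) :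
    lagrangeError 𝕜 s v x f = lagrangeError 𝕜 s v x g := by
  rw [lagrangeError, lagrangeError, hx, Finset.sum_congr rfl fun i hi => by rw [hv i hi]]

theorem map_lagrangeError {𝕜 𝕜' V W F : Type*} [RCLike 𝕜] [RCLike 𝕜'] [AddCommGroup V]
    [Module 𝕜 V] [AddCommGroup W] [Module 𝕜' W] [FunLike F V W] [AddMonoidHomClass F V W] (j : F)
    (hj : ∀ (r : ℝ) (y : V), j ((r : 𝕜) • y) = (r : 𝕜') • j y) (f : ℝ → V) :
    j (lagrangeError 𝕜 s v x f) = lagrangeError 𝕜' s v x fun a => j (f a) := by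
  simp only [lagrangeError, map_sub, map_sum, hj]

theorem lagrangeError_eval_eq_zero (hv : Set.InjOn v s) {P : Polynomial ℝ}
    (hP : P.degree < s.card) : lagrangeError ℝ s v x (fun a => P.eval a) = 0 := by
  have h := congrArg (Polynomial.eval x) (Lagrange.eq_interpolate hv hP)
  rw [Lagrange.interpolate_apply, Polynomial.eval_finsetSum] at h
  rw [lagrangeError, sub_eq_zero, h]
  exact Finset.sum_congr rfl fun i _ => by
    rw [Polynomial.eval_mul, Polynomial.eval_C, smul_eq_mul, mul_comm, RCLike.ofReal_real_eq_id,
      id_eq]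

theorem norm_sum_eval_basis_smul_le {𝕜 V : Type*} [RCLike 𝕜] [NormedAddCommGroup V]
    [NormedSpace 𝕜 V] {f : ℝ → V} {C : ℝ} (hf : ∀ i ∈ s, ‖f (v i)‖ ≤ C) :
    ‖∑ i ∈ s, (((Lagrange.basis s v i).eval x : ℝ) : 𝕜) • f (v i)‖ ≤
      lebesgueFunction s v x * C := by
  rw [lebesgueFunction, Finset.sum_mul]
  refine norm_sum_le_of_le s fun i hi => ?_
  rw [norm_smul, RCLike.norm_ofReal]
  exact mul_le_mul_of_nonneg_left (hf i hi) (abs_nonneg _)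

theorem norm_lagrangeError_le {𝕜 V : Type*} [RCLike 𝕜] [NormedAddCommGroup V]
    [NormedSpace 𝕜 V] {f : ℝ → V} {C : ℝ} (hx : ‖f x‖ ≤ C) (hf : ∀ i ∈ s, ‖f (v i)‖ ≤ C) :
    ‖lagrangeError 𝕜 s v x f‖ ≤ (1 + lebesgueFunction s v x) * C := by
  rw [one_add_mul]
  exact (norm_sub_le _ _).trans (add_le_add hx (norm_sum_eval_basis_smul_le hf))

theorem norm_le_norm_lagrangeError_add {𝕜 V : Type*} [RCLike 𝕜] [NormedAddCommGroup V]
    [NormedSpace 𝕜 V] {f : ℝ → V} {C : ℝ} (hf : ∀ i ∈ s, ‖f (v i)‖ ≤ C) :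
    ‖f x‖ ≤ ‖lagrangeError 𝕜 s v x f‖ + lebesgueFunction s v x * C :=
  (norm_le_norm_sub_add _ _).trans (add_le_add le_rfl (norm_sum_eval_basis_smul_le hf))

theorem hasSum_lagrangeError_smul {𝕜 V : Type*} [RCLike 𝕜] [NormedAddCommGroup V]
    [NormedSpace 𝕜 V] {φ : ℕ → ℝ → ℝ} {a : ℕ → V} {f : ℝ → V}
    (hx : HasSum (fun m => (φ m x : 𝕜) • a m) (f x))
    (hv : ∀ i ∈ s, HasSum (fun m => (φ m (v i) : 𝕜) • a m) (f (v i))) :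
    HasSum (fun m => ((lagrangeError ℝ s v x (φ m) : ℝ) : 𝕜) • a m) (lagrangeError 𝕜 s v x f) := by
  convert! hx.sub (hasSum_sum fun i hi =>
    (hv i hi).const_smul (((Lagrange.basis s v i).eval x : ℝ) : 𝕜)) using 2 with m
  simp only [lagrangeError, RCLike.ofReal_real_eq_id, id_eq, smul_eq_mul, RCLike.ofReal_sub,
    RCLike.ofReal_sum, RCLike.ofReal_mul, sub_smul, Finset.sum_smul, mul_smul]

theorem norm_lagrangeError_le_of_hasSum {𝕜 V : Type*} [RCLike 𝕜] [NormedAddCommGroup V]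
    [NormedSpace 𝕜 V] {a : ℕ → V} {f : ℝ → V} {y R M ρ : ℝ} (hR : 0 < R) (hM : 0 ≤ M)
    (hρ0 : 0 ≤ ρ) (hρ : ρ ≤ 1 / 2) (ha : ∀ m, ‖a m‖ ≤ M / R ^ m)
    (hf : ∀ t, |t - y| ≤ ρ * R → HasSum (fun m => (((t - y) ^ m : ℝ) : 𝕜) • a m) (f t))
    (hinj : Set.InjOn v s) (hx : |x - y| ≤ ρ * R) (hv : ∀ i ∈ s, |v i - y| ≤ ρ * R) :
    ‖lagrangeError 𝕜 s v x f‖ ≤ 2 * (1 + lebesgueFunction s v x) * M * ρ ^ s.card := by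
  set ε : ℕ → ℝ := fun m => lagrangeError ℝ s v x fun t => (t - y) ^ m
  have hΛ := lebesgueFunction_nonneg s v x
  have hlow (m : ℕ) (hm : m < s.card) : ε m = 0 := by
    have hdeg : ((Polynomial.X - Polynomial.C y) ^ m : Polynomial ℝ).degree < s.card := by
      simpa [Polynomial.degree_pow] using hm
    simpa [ε] using lagrangeError_eval_eq_zero (x := x) hinj hdeg
  have hpow (m : ℕ) (t : ℝ) (ht : |t - y| ≤ ρ * R) : ‖(t - y) ^ m‖ ≤ (ρ * R) ^ m := by
    rw [norm_pow, Real.norm_eq_abs]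
    gcongr
  have hε (m : ℕ) : ‖ε m‖ ≤ (1 + lebesgueFunction s v x) * (ρ * R) ^ m :=
    norm_lagrangeError_le (f := fun t => (t - y) ^ m) (hpow m x hx) fun i hi => hpow m _ (hv i hi)
  have hterm (m : ℕ) : ‖((ε m : ℝ) : 𝕜) • a m‖ ≤ (1 + lebesgueFunction s v x) * M * ρ ^ m := by
    rw [norm_smul, RCLike.norm_ofReal, ← Real.norm_eq_abs]
    calc ‖ε m‖ * ‖a m‖ ≤ (1 + lebesgueFunction s v x) * (ρ * R) ^ m * (M / R ^ m) :=
          mul_le_mul (hε m) (ha m) (norm_nonneg _) (by positivity)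
      _ = (1 + lebesgueFunction s v x) * M * ρ ^ m := by
          rw [mul_pow]
          field_simp
  have htail : HasSum (fun m => ((ε (m + s.card) : ℝ) : 𝕜) • a (m + s.card))
      (lagrangeError 𝕜 s v x f) := by
    rw [hasSum_nat_add_iff s.card (f := fun m => ((ε m : ℝ) : 𝕜) • a m), Finset.sum_eq_zero
      fun m hm => by rw [hlow m (Finset.mem_range.1 hm), RCLike.ofReal_zero, zero_smul], add_zero]
    exact hasSum_lagrangeError_smul (φ := fun m t => (t - y) ^ m) (hf x hx) fun i hi =>
      hf _ (hv i hi)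
  have hgeom := hasSum_geometric_two.mul_left ((1 + lebesgueFunction s v x) * M * ρ ^ s.card)
  refine (htail.norm_le_of_bounded hgeom fun m => (hterm _).trans ?_).trans_eq (by ring)
  rw [pow_add, mul_comm (ρ ^ m), ← mul_assoc]
  gcongr

theorem norm_lagrangeError_le_of_diffContOnCl {Y : Type*} [NormedAddCommGroup Y] [NormedSpace ℂ Y]
    [CompleteSpace Y] {h : ℂ → Y} {y R M ρ : ℝ} (hR : 0 < R)
    (hd : DiffContOnCl ℂ h (Metric.ball (y : ℂ) R))
    (hM : ∀ z ∈ Metric.sphere (y : ℂ) R, ‖h z‖ ≤ M) (hρ0 : 0 ≤ ρ) (hρ : ρ ≤ 1 / 2)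
    (hinj : Set.InjOn v s) (hx : |x - y| ≤ ρ * R) (hv : ∀ i ∈ s, |v i - y| ≤ ρ * R) :
    ‖lagrangeError ℂ s v x fun a => h a‖ ≤
      2 * (1 + lebesgueFunction s v x) * M * ρ ^ s.card := by
  obtain ⟨z, hz⟩ : (Metric.sphere (y : ℂ) R).Nonempty := NormedSpace.sphere_nonempty.2 hR.le
  refine norm_lagrangeError_le_of_hasSum (a := fun m => (m.factorial : ℂ)⁻¹ • iteratedDeriv m h y)
    hR ((norm_nonneg _).trans (hM z hz)) hρ0 hρ (fun m => ?_) (fun t ht => ?_) hinj hx hv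
  · have hcauchy := Complex.norm_iteratedDeriv_le_of_forall_mem_sphere_norm_le m hR hd hM
    rwa [norm_smul, norm_inv, Complex.norm_natCast,
      inv_mul_le_iff₀ (Nat.cast_pos.2 m.factorial_pos), ← mul_div_assoc]
  · have htR : (t : ℂ) ∈ Metric.ball (y : ℂ) R := by
      rw [Metric.mem_ball, dist_eq_norm, ← Complex.ofReal_sub, Complex.norm_real, Real.norm_eq_abs]
      nlinarith
    convert! Complex.hasSum_taylorSeries_on_ball hd.differentiableOn htR using 2 with m
    rw [smul_comm, RCLike.ofReal_eq_complex_ofReal, Complex.ofReal_pow, Complex.ofReal_sub]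

end LagrangeError

/-! ### Holomorphic extension of analytic semigroups -/

theorem exists_ball_subset_openSector {θ : ℝ} (hθ : 0 < θ) :
    ∃ c : ℝ, 0 < c ∧ ∀ x : ℝ, 0 < x → Metric.ball (x : ℂ) (c * x) ⊆ openSector θ := by
  have hone : ∀ᶠ z : ℂ in 𝓝 1, z ≠ 0 ∧ |z.arg| < θ := by
    have harg : ContinuousAt (fun z : ℂ => |z.arg|) 1 := (Complex.continuousAt_arg (by simp)).abs
    exact (eventually_ne_nhds one_ne_zero).and
      (harg.eventually_lt continuousAt_const (by simpa using hθ))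
  obtain ⟨c, hc, hball⟩ := Metric.eventually_nhds_iff_ball.1 hone
  refine ⟨c, hc, fun x hx z hz => ?_⟩
  have hx' : (x : ℂ) ≠ 0 := Complex.ofReal_ne_zero.2 hx.ne'
  have hzx : z / x ∈ Metric.ball (1 : ℂ) c := by
    rw [Metric.mem_ball, dist_eq_norm] at hz ⊢
    rwa [div_sub_one hx', norm_div, Complex.norm_of_nonneg hx.le, div_lt_iff₀ hx]
  have hsector := hball _ hzx
  rw [← mul_div_cancel₀ z hx', openSector, mem_ofPred_eq, Complex.arg_real_mul _ hx]
  exact ⟨mul_ne_zero hx' hsector.1, hsector.2⟩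

theorem IsSectorSemigroup.exists_norm_le {Y : Type*} [NormedAddCommGroup Y]
    [InnerProductSpace ℂ Y] [CompleteSpace Y] {θ : ℝ} {T : ℂ → Y →L[ℂ] Y}
    (hT : IsSectorSemigroup θ T) :
    ∃ δ M : ℝ, 0 < δ ∧ ∀ z ∈ openSector θ, ‖z‖ < δ → ‖T z‖ ≤ M := by
  by_contra! hcon
  choose z hz hz0 hzT using fun n : ℕ => hcon (1 / ((n : ℝ) + 1)) n Nat.one_div_pos_of_nat
  have hlim : Tendsto z atTop (𝓝[openSector θ] 0) :=
    tendsto_nhdsWithin_iff.2 ⟨squeeze_zero_norm (fun n => (hz0 n).le)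
      tendsto_one_div_add_atTop_nhds_zero_nat, Eventually.of_forall hz⟩
  obtain ⟨C, hC⟩ := banach_steinhaus (g := fun n => T (z n)) fun y => by
    obtain ⟨C, hC⟩ := ((hT.tendsto_zero y).comp hlim).norm.bddAbove_range
    exact ⟨C, fun n => hC ⟨n, rfl⟩⟩
  obtain ⟨n, hn⟩ := exists_nat_gt C
  linarith [hC n, hzT n]

theorem scalarToComplex_ofReal {𝕜 : Type*} [RCLike 𝕜] (r : ℝ) :
    scalarToComplex ((r : ℝ) : 𝕜) = (r : ℂ) := by
  simp [scalarToComplex]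

theorem IsComplexification.norm_map {𝕜 : Type*} [RCLike 𝕜] {X Y : Type u} [NormedAddCommGroup X]
    [InnerProductSpace 𝕜 X] [NormedAddCommGroup Y] [InnerProductSpace ℂ Y] {j : X →+ Y}
    (hj : IsComplexification 𝕜 j) (x : X) : ‖j x‖ = ‖x‖ := by
  have hsq : ((‖j x‖ ^ 2 : ℝ) : ℂ) = ((‖x‖ ^ 2 : ℝ) : ℂ) := by
    rw [← scalarToComplex_ofReal (𝕜 := 𝕜) (‖x‖ ^ 2), RCLike.ofReal_pow,
      ← inner_self_eq_norm_sq_to_K, ← hj.inner_map, inner_self_eq_norm_sq_to_K, Complex.ofReal_pow]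
    rfl
  exact (sq_eq_sq₀ (norm_nonneg _) (norm_nonneg _)).1 (Complex.ofReal_injective hsq)

/-- `T` extends `S`, along the isometry `j : X → Y`, holomorphically to the discs of centre `τ > 0`
and radius `c τ`, with operator norms at most `M` on those of centre `τ < δ`. This is all that is
used of the analyticity of a semigroup. -/
structure IsDiscExtension {𝕜 : Type*} [RCLike 𝕜] {X Y : Type*} [NormedAddCommGroup X]
    [NormedSpace 𝕜 X] [NormedAddCommGroup Y] [NormedSpace ℂ Y] (S : ℝ → X →L[𝕜] X)
    (j : X →+ Y) (T : ℂ → Y →L[ℂ] Y) (c δ M : ℝ) : Prop where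
  c_pos : 0 < c
  c_lt_one : c < 1
  δ_pos : 0 < δ
  norm_map : ∀ x : X, ‖j x‖ = ‖x‖
  map_ofReal_smul : ∀ (r : ℝ) (x : X), j ((r : 𝕜) • x) = (r : ℂ) • j x
  apply_ofReal : ∀ t : ℝ, 0 < t → ∀ x : X, T t (j x) = j (S t x)
  differentiableOn : ∀ τ : ℝ, 0 < τ → DifferentiableOn ℂ T (Metric.closedBall τ (c * τ))
  norm_le : ∀ τ ∈ Ioo 0 δ, ∀ z ∈ Metric.closedBall (τ : ℂ) (c * τ), ‖T z‖ ≤ M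

theorem IsAnalyticSemigroup.exists_isDiscExtension {𝕜 : Type*} [RCLike 𝕜] {X : Type u}
    [NormedAddCommGroup X] [InnerProductSpace 𝕜 X] {S : ℝ → X →L[𝕜] X}
    (hS : IsAnalyticSemigroup S) :
    ∃ (Y : Type u) (_ : NormedAddCommGroup Y) (_ : InnerProductSpace ℂ Y) (_ : CompleteSpace Y)
      (j : X →+ Y) (T : ℂ → Y →L[ℂ] Y) (c δ M : ℝ), IsDiscExtension S j T c δ M := by
  obtain ⟨Y, hY₁, hY₂, hY₃, j, θ, T, hj, hT, hTS⟩ := hS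
  obtain ⟨c, hc, hball⟩ := exists_ball_subset_openSector hT.pos
  obtain ⟨δ, M, hδ, hM⟩ := hT.exists_norm_le
  have hc' : min c 1 / 2 < c := (half_lt_self (lt_min hc one_pos)).trans_le (min_le_left c 1)
  have hc1 : min c 1 / 2 < 1 := (half_lt_self (lt_min hc one_pos)).trans_le (min_le_right c 1)
  have hsector (τ : ℝ) (hτ : 0 < τ) :
      Metric.closedBall (τ : ℂ) (min c 1 / 2 * τ) ⊆ openSector θ :=
    (Metric.closedBall_subset_ball (mul_lt_mul_of_pos_right hc' hτ)).trans (hball τ hτ)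
  refine ⟨Y, hY₁, hY₂, hY₃, j, T, min c 1 / 2, δ / 2, M, half_pos (lt_min hc one_pos), hc1,
    half_pos hδ, hj.norm_map, fun r x => by rw [hj.map_smul, scalarToComplex_ofReal], hTS,
    fun τ hτ => hT.differentiableOn.mono (hsector τ hτ), fun τ hτ z hz => ?_⟩
  refine hM z (hsector τ hτ.1 hz) ?_
  have hz' : ‖z - τ‖ ≤ min c 1 / 2 * τ := mem_closedBall_iff_norm.1 hz
  have hnorm := norm_le_norm_add_norm_sub' z (τ : ℂ)
  rw [Complex.norm_of_nonneg hτ.1.le] at hnorm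
  nlinarith [hτ.1, hτ.2]

namespace IsDiscExtension

variable {𝕜 : Type*} [RCLike 𝕜] {X Y : Type*} [NormedAddCommGroup X] [InnerProductSpace 𝕜 X]
  [NormedAddCommGroup Y] [NormedSpace ℂ Y] {S : ℝ → X →L[𝕜] X} {j : X →+ Y}
  {T : ℂ → Y →L[ℂ] Y} {c δ M τ : ℝ}

theorem M_nonneg (H : IsDiscExtension S j T c δ M) : 0 ≤ M :=
  (norm_nonneg _).trans (H.norm_le (δ / 2) ⟨half_pos H.δ_pos, half_lt_self H.δ_pos⟩ _
    (Metric.mem_closedBall_self (mul_nonneg H.c_pos.le (half_pos H.δ_pos).le)))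

theorem radius_pos (H : IsDiscExtension S j T c δ M) (hτ : 0 < τ) : 0 < c * τ :=
  mul_pos H.c_pos hτ

theorem diffContOnCl (H : IsDiscExtension S j T c δ M) (hτ : 0 < τ) (y : Y) :
    DiffContOnCl ℂ (fun z => T z y) (Metric.ball τ (c * τ)) := by
  refine DifferentiableOn.diffContOnCl ?_
  rw [closure_ball _ (H.radius_pos hτ).ne']
  exact (H.differentiableOn τ hτ).clm_apply (differentiableOn_const y)

theorem differentiableAt (H : IsDiscExtension S j T c δ M) (hτ : 0 < τ) (y : Y) :
    DifferentiableAt ℂ (fun z => T z y) τ :=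
  (H.diffContOnCl hτ y).differentiableAt Metric.isOpen_ball
    (Metric.mem_ball_self (H.radius_pos hτ))

theorem norm_apply_map_le (H : IsDiscExtension S j T c δ M) (hτ : τ ∈ Ioo 0 δ) (x : X) {z : ℂ}
    (hz : z ∈ Metric.closedBall (τ : ℂ) (c * τ)) : ‖T z (j x)‖ ≤ M * ‖x‖ := by
  rw [← H.norm_map x]
  exact (T z).le_of_opNorm_le (H.norm_le τ hτ z hz) _

theorem norm_semigroup_le (H : IsDiscExtension S j T c δ M) (hτ : τ ∈ Ioo 0 δ) (x : X) :
    ‖S τ x‖ ≤ M * ‖x‖ := by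
  rw [← H.norm_map (S τ x), ← H.apply_ofReal τ hτ.1]
  exact H.norm_apply_map_le hτ x (Metric.mem_closedBall_self (H.radius_pos hτ.1).le)

theorem isometry (H : IsDiscExtension S j T c δ M) : Isometry j :=
  AddMonoidHomClass.isometry_of_norm j H.norm_map

theorem continuousOn_orbit (H : IsDiscExtension S j T c δ M) (hS : IsC0Semigroup S) (x : X) :
    ContinuousOn (fun t => S t x) (Ici 0) := by
  intro t ht
  obtain rfl | ht := eq_or_lt_of_le (mem_Ici.1 ht)
  · rw [← continuousWithinAt_Ioi_iff_Ici, ContinuousWithinAt, hS.map_zero]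
    exact hS.tendsto_zero x
  · have hT : ContinuousAt (fun a : ℝ => T a (j x)) t :=
      (H.differentiableAt ht (j x)).continuousAt.comp Complex.continuous_ofReal.continuousAt
    have hj : ContinuousAt (fun a : ℝ => j (S a x)) t :=
      hT.congr ((eventually_gt_nhds ht).mono fun a ha => H.apply_ofReal a ha x)
    exact (H.isometry.isUniformInducing.isInducing.continuousAt_iff.2 hj).continuousWithinAt

theorem map_eq_deriv (H : IsDiscExtension S j T c δ M) (hS : IsC0Semigroup S)
    {A : X →ₗ.[𝕜] X} (hA : IsInfinitesimalGenerator A S) {t : ℝ} (ht : 0 < t) {x y : X}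
    (hy : (S t x, y) ∈ A.graph) : j y = deriv (fun z => T z (j x)) t := by
  have hgen : Tendsto (fun h : ℝ => j (((h⁻¹ : ℝ) : 𝕜) • (S h (S t x) - S t x))) (𝓝[>] 0)
      (𝓝 (j y)) := (H.isometry.continuous.tendsto y).comp ((hA _ _).1 hy)
  have hderiv : HasDerivAt (fun a : ℝ => T a (j x)) (deriv (fun z => T z (j x)) t) t := by
    simpa [Function.comp_def] using
      (H.differentiableAt ht (j x)).hasDerivAt.scomp t Complex.ofRealCLM.hasDerivAt
  refine tendsto_nhds_unique hgen (hderiv.tendsto_slope_zero_right.congr' ?_)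
  filter_upwards [self_mem_nhdsWithin] with h (hh : 0 < h)
  rw [H.map_ofReal_smul, map_sub, H.apply_ofReal t ht, H.apply_ofReal (t + h) (by positivity),
    add_comm t h, hS.map_add h t hh.le ht.le, ContinuousLinearMap.comp_apply, Complex.coe_smul]

theorem norm_generator_le (H : IsDiscExtension S j T c δ M) (hS : IsC0Semigroup S)
    {A : X →ₗ.[𝕜] X} (hA : IsInfinitesimalGenerator A S) (hτ : τ ∈ Ioo 0 δ) {x y : X}
    (hy : (S τ x, y) ∈ A.graph) : ‖y‖ ≤ M / (c * τ) * ‖x‖ := by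
  rw [← H.norm_map y, H.map_eq_deriv hS hA hτ.1 hy, div_mul_eq_mul_div]
  exact Complex.norm_deriv_le_of_forall_mem_sphere_norm_le (H.radius_pos hτ.1)
    (H.diffContOnCl hτ.1 (j x))
    fun z hz => H.norm_apply_map_le hτ x (Metric.sphere_subset_closedBall hz)

theorem lt_of_abs_sub_le (H : IsDiscExtension S j T c δ M) (hτ : 0 < τ) {a ρ σ : ℝ}
    (hρ : ρ ≤ 1 / 2) (ha : |a - (σ + τ)| ≤ ρ * (c * τ)) : σ < a := by
  have hcτ : c * τ < τ := mul_lt_of_lt_one_left hτ H.c_lt_one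
  nlinarith [(abs_le.1 ha).1, H.radius_pos hτ]

theorem norm_lagrangeError_orbit_le [CompleteSpace Y] (H : IsDiscExtension S j T c δ M)
    (hτ : τ ∈ Ioo 0 δ) {ι : Type*} [DecidableEq ι] {s : Finset ι} {v : ι → ℝ} {x ρ σ : ℝ}
    (hρ0 : 0 ≤ ρ) (hρ : ρ ≤ 1 / 2) (hinj : Set.InjOn v s) (hx : |x - (σ + τ)| ≤ ρ * (c * τ))
    (hv : ∀ i ∈ s, |v i - (σ + τ)| ≤ ρ * (c * τ)) (u : X) :
    ‖lagrangeError 𝕜 s v x fun a => S (a - σ) u‖ ≤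
      2 * (1 + lebesgueFunction s v x) * (M * ‖u‖) * ρ ^ s.card := by
  have hext (a : ℝ) (ha : |a - (σ + τ)| ≤ ρ * (c * τ)) :
      j (S (a - σ) u) = T (a - σ) (j u) := by
    rw [← Complex.ofReal_sub, H.apply_ofReal _ (sub_pos.2 (H.lt_of_abs_sub_le hτ.1 hρ ha))]
  have hball : MapsTo (fun z : ℂ => z - σ) (Metric.ball ((σ + τ : ℝ) : ℂ) (c * τ))
      (Metric.ball (τ : ℂ) (c * τ)) := by
    intro z hz
    rw [mem_ball_iff_norm] at hz ⊢
    rwa [sub_sub, ← Complex.ofReal_add]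
  have hsphere (z : ℂ) (hz : z ∈ Metric.sphere ((σ + τ : ℝ) : ℂ) (c * τ)) :
      z - σ ∈ Metric.closedBall (τ : ℂ) (c * τ) := by
    rw [mem_closedBall_iff_norm, sub_sub, ← Complex.ofReal_add]
    exact (mem_sphere_iff_norm.1 hz).le
  rw [← H.norm_map, map_lagrangeError (𝕜' := ℂ) j H.map_ofReal_smul,
    lagrangeError_congr (g := fun a : ℝ => T (a - σ) (j u)) (hext x hx)
      fun i hi => hext _ (hv i hi)]
  exact norm_lagrangeError_le_of_diffContOnCl (h := fun z => T (z - σ) (j u)) (H.radius_pos hτ.1)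
    ((H.diffContOnCl hτ.1 (j u)).comp (differentiable_id.sub_const _).diffContOnCl hball)
    (fun z hz => H.norm_apply_map_le hτ u (hsphere z hz)) hρ0 hρ hinj hx hv

end IsDiscExtension

/-! ### The observation along an orbit -/

theorem IsC0Semigroup.apply_map_eq {𝕜 : Type*} [RCLike 𝕜] {X : Type*} [NormedAddCommGroup X]
    [InnerProductSpace 𝕜 X] {S : ℝ → X →L[𝕜] X} {A : X →ₗ.[𝕜] X} (hS : IsC0Semigroup S)
    (hA : IsInfinitesimalGenerator A S) {t : ℝ} (ht : 0 ≤ t) (x : A.domain) :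
    A ⟨S t x, hS.map_mem_domain hA ht x⟩ = S t (A x) := by
  refine (LinearPMap.image_iff (hS.map_mem_domain hA ht x)).2 ((hA _ _).2 ?_) |>.symm
  refine (((S t).continuous.tendsto (A x)).comp ((hA x (A x)).1 (A.mem_graph x))).congr' ?_
  filter_upwards [self_mem_nhdsWithin] with h (hh : 0 < h)
  have hcomm : S h (S t x) = S t (S h x) := by
    rw [← ContinuousLinearMap.comp_apply, ← ContinuousLinearMap.comp_apply,
      ← hS.map_add h t hh.le ht, ← hS.map_add t h ht hh.le, add_comm]
  rw [Function.comp_apply, map_smul, map_sub, hcomm]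

section Observation

variable {𝕜 : Type*} [RCLike 𝕜] {X : Type*} [NormedAddCommGroup X] [InnerProductSpace 𝕜 X]
  {U : Type*} [NormedAddCommGroup U] [InnerProductSpace 𝕜 U] {A : X →ₗ.[𝕜] X}
  {S : ℝ → X →L[𝕜] X} {B : A.domain →ₗ[𝕜] U} {b : ℝ}

theorem observe_eq (hS : IsC0Semigroup S) (hA : IsInfinitesimalGenerator A S) (u₀ : A.domain)
    {t : ℝ} (ht : 0 ≤ t) : observe S B u₀ t = B ⟨S t u₀, hS.map_mem_domain hA ht u₀⟩ :=
  dif_pos (hS.map_mem_domain hA ht u₀)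

theorem map_observe_id (u₀ : A.domain) (t : ℝ) :
    B (observe S LinearMap.id u₀ t) = observe S B u₀ t := by
  unfold observe
  split_ifs with h
  · rfl
  · exact map_zero B

theorem observe_map (hS : IsC0Semigroup S) (hA : IsInfinitesimalGenerator A S) (u₀ : A.domain)
    {a t : ℝ} (ha : 0 ≤ a) (ht : 0 ≤ t) :
    observe S B ⟨S a u₀, hS.map_mem_domain hA ha u₀⟩ t = observe S B u₀ (a + t) := by
  rw [observe_eq hS hA _ ht, observe_eq hS hA _ (add_nonneg ha ht)]
  congr 2
  rw [add_comm a t, hS.map_add t a ht ha]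
  rfl

theorem ObservationBoundedBy.norm_le (hB : ObservationBoundedBy B b) (x : A.domain) :
    ‖B x‖ ≤ |b| * (‖(x : X)‖ + ‖A x‖) :=
  (hB x).trans (mul_le_mul_of_nonneg_right (le_abs_self b)
    (add_nonneg (norm_nonneg _) (norm_nonneg _)))

namespace IsDiscExtension

variable {Y : Type*} [NormedAddCommGroup Y] [NormedSpace ℂ Y] {j : X →+ Y}
  {T : ℂ → Y →L[ℂ] Y} {c δ M τ : ℝ}

theorem continuousOn_observe (H : IsDiscExtension S j T c δ M) (hS : IsC0Semigroup S)
    (hA : IsInfinitesimalGenerator A S) (hB : ObservationBoundedBy B b) (u₀ : A.domain) :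
    ContinuousOn (observe S B u₀) (Ici 0) := by
  intro t ht
  have hu := tendsto_iff_norm_sub_tendsto_zero.1 (H.continuousOn_orbit hS (u₀ : X) t ht)
  have hAu := tendsto_iff_norm_sub_tendsto_zero.1 (H.continuousOn_orbit hS (A u₀) t ht)
  have hlim : Tendsto (fun a => |b| * (‖S a (u₀ : X) - S t (u₀ : X)‖ + ‖S a (A u₀) - S t (A u₀)‖))
      (𝓝[Ici 0] t) (𝓝 0) := by
    simpa using (hu.add hAu).const_mul |b|
  rw [ContinuousWithinAt, tendsto_iff_norm_sub_tendsto_zero]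
  refine squeeze_zero' (Eventually.of_forall fun _ => norm_nonneg _) ?_ hlim
  filter_upwards [self_mem_nhdsWithin] with a ha
  rw [observe_eq hS hA _ ha, observe_eq hS hA _ ht, ← map_sub]
  refine (hB.norm_le _).trans_eq ?_
  rw [A.map_sub, hS.apply_map_eq hA ha, hS.apply_map_eq hA ht]
  rfl

theorem integrableOn_norm_observe (H : IsDiscExtension S j T c δ M) (hS : IsC0Semigroup S)
    (hA : IsInfinitesimalGenerator A S) (hB : ObservationBoundedBy B b) (u₀ : A.domain) {a : ℝ}
    {E : Set ℝ} (hE : E ⊆ Icc 0 a) : IntegrableOn (fun t => ‖observe S B u₀ t‖) E :=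
  (ContinuousOn.integrableOn_Icc
    ((H.continuousOn_observe hS hA hB u₀).norm.mono Icc_subset_Ici_self)).mono_set hE

theorem norm_observation_le (H : IsDiscExtension S j T c δ M) (hS : IsC0Semigroup S)
    (hA : IsInfinitesimalGenerator A S) (hB : ObservationBoundedBy B b) (hτ : τ ∈ Ioo 0 δ)
    {z : A.domain} {x : X} (hz : (z : X) = S τ x) :
    ‖B z‖ ≤ |b| * (M + M / (c * τ)) * ‖x‖ := by
  have hnorm : ‖(z : X)‖ ≤ M * ‖x‖ := hz ▸ H.norm_semigroup_le hτ x
  have hgen : ‖A z‖ ≤ M / (c * τ) * ‖x‖ :=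
    H.norm_generator_le hS hA hτ (hz ▸ A.mem_graph z)
  calc ‖B z‖ ≤ |b| * (‖(z : X)‖ + ‖A z‖) := hB.norm_le z
    _ ≤ |b| * (M * ‖x‖ + M / (c * τ) * ‖x‖) := by gcongr
    _ = |b| * (M + M / (c * τ)) * ‖x‖ := by ring

theorem norm_lagrangeError_observe_le [CompleteSpace Y] (H : IsDiscExtension S j T c δ M)
    (hS : IsC0Semigroup S) (hA : IsInfinitesimalGenerator A S) (hB : ObservationBoundedBy B b)
    (hτ : τ ∈ Ioo 0 δ) {ι : Type*} [DecidableEq ι] {s : Finset ι} {v : ι → ℝ} {x ρ : ℝ}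
    (hρ0 : 0 ≤ ρ) (hρ : ρ ≤ 1 / 2) (hinj : Set.InjOn v s) (hx : |x - (τ + τ)| ≤ ρ * (c * τ))
    (hv : ∀ i ∈ s, |v i - (τ + τ)| ≤ ρ * (c * τ)) (u₀ : A.domain) :
    ‖lagrangeError 𝕜 s v x (observe S B u₀)‖ ≤ |b| * (M + M / (c * τ)) *
      (2 * (1 + lebesgueFunction s v x) * (M * ‖(u₀ : X)‖) * ρ ^ s.card) := by
  have hM := H.M_nonneg
  have hcτ := H.radius_pos hτ.1
  have hcoe (a : ℝ) (ha : |a - (τ + τ)| ≤ ρ * (c * τ)) :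
      ((observe S LinearMap.id u₀ a : A.domain) : X) = S τ (S (a - τ) u₀) := by
    have hτa := H.lt_of_abs_sub_le hτ.1 hρ ha
    rw [observe_eq hS hA u₀ (hτ.1.trans hτa).le, LinearMap.id_apply,
      ← ContinuousLinearMap.comp_apply, ← hS.map_add _ _ hτ.1.le (sub_nonneg.2 hτa.le),
      add_sub_cancel]
  have hz : ((lagrangeError 𝕜 s v x (observe S LinearMap.id u₀) : A.domain) : X) =
      S τ (lagrangeError 𝕜 s v x fun a => S (a - τ) u₀) := by
    rw [← Submodule.subtype_apply, map_lagrangeError _ fun _ _ => map_smul _ _ _,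
      map_lagrangeError _ fun _ _ => map_smul _ _ _]
    exact lagrangeError_congr (hcoe x hx) fun i hi => hcoe _ (hv i hi)
  have hobserve : lagrangeError 𝕜 s v x (observe S B u₀) =
      B (lagrangeError 𝕜 s v x (observe S LinearMap.id u₀)) := by
    simp only [map_lagrangeError B fun _ _ => map_smul B _ _, map_observe_id]
  rw [hobserve]
  refine (H.norm_observation_le hS hA hB hτ hz).trans ?_
  gcongr
  exact H.norm_lagrangeError_orbit_le hτ hρ0 hρ hinj hx hv _

end IsDiscExtension

namespace IntervalObservability

theorem mono {d k d' k' : ℝ} (hobs : IntervalObservability S B d k) (hd : d ≤ d') (hd' : 0 ≤ d')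
    (hk : k ≤ k') : IntervalObservability S B d' k' := by
  intro L hL hL1 u₀
  have hpow : L ^ k' ≤ L ^ k := Real.rpow_le_rpow_of_exponent_ge hL hL1 hk
  have hdiv : d / L ^ k ≤ d' / L ^ k' := by gcongr
  refine (hobs L hL hL1 u₀).trans (mul_le_mul_of_nonneg_right (Real.exp_le_exp.2 hdiv) ?_)
  exact intervalIntegral.integral_nonneg hL.le fun _ _ => sq_nonneg _

theorem norm_le_exp_mul {d k : ℝ} (hobs : IntervalObservability S B d k) (hS : IsC0Semigroup S)
    (hA : IsInfinitesimalGenerator A S) (hd : 0 ≤ d) (u₀ : A.domain) {a l F : ℝ} (ha : 0 ≤ a)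
    (hl : 0 < l) (hl1 : l ≤ 1) (hF : ∀ t ∈ Icc a (a + l), ‖observe S B u₀ t‖ ≤ F) :
    ‖S (a + l) u₀‖ ≤ Real.exp (d / l ^ k) * F := by
  have hF0 : 0 ≤ F := (norm_nonneg _).trans (hF a ⟨le_rfl, le_add_of_nonneg_right hl.le⟩)
  set u₁ : A.domain := ⟨S a u₀, hS.map_mem_domain hA ha u₀⟩
  have hint : ∫ t in (0 : ℝ)..l, ‖observe S B u₁ t‖ ^ 2 ≤ F ^ 2 := by
    have hle (t : ℝ) (ht : t ∈ uIoc 0 l) : ‖‖observe S B u₁ t‖ ^ 2‖ ≤ F ^ 2 := by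
      rw [uIoc_of_le hl.le] at ht
      rw [observe_map hS hA u₀ ha ht.1.le, norm_pow, norm_norm]
      gcongr
      exact hF (a + t) ⟨le_add_of_nonneg_right ht.1.le, add_le_add_right ht.2 a⟩
    refine (le_abs_self _).trans ((intervalIntegral.norm_integral_le_of_norm_le_const hle).trans ?_)
    rw [sub_zero, abs_of_pos hl]
    exact mul_le_of_le_one_right (sq_nonneg F) hl1
  have hexp : 1 ≤ Real.exp (d / l ^ k) := Real.one_le_exp (by positivity)
  have hS_add : S (a + l) (u₀ : X) = S l u₁ := by
    rw [add_comm, hS.map_add l a hl.le ha]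
    rfl
  refine (sq_le_sq₀ (norm_nonneg _) (by positivity)).1 ?_
  calc ‖S (a + l) (u₀ : X)‖ ^ 2
      ≤ Real.exp (d / l ^ k) * ∫ t in (0 : ℝ)..l, ‖observe S B u₁ t‖ ^ 2 :=
        hS_add ▸ hobs l hl hl1 u₁
    _ ≤ Real.exp (d / l ^ k) * F ^ 2 := by gcongr
    _ ≤ (Real.exp (d / l ^ k)) ^ 2 * F ^ 2 := by
        gcongr
        exact le_self_pow₀ hexp two_ne_zero
    _ = (Real.exp (d / l ^ k) * F) ^ 2 := (mul_pow _ _ _).symm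

end IntervalObservability

end Observation

/-! ### Sets of times of positive measure -/

theorem measure_univ_le_measure_le_integral_add {Ω : Type*} [MeasurableSpace Ω] {μ : Measure Ω}
    [IsFiniteMeasure μ] {f : Ω → ℝ} (hf0 : ∀ x, 0 ≤ f x) (hf : Integrable f μ) {c : ℝ}
    (hc : 0 < c) : μ univ ≤ μ {x | f x ≤ c * ∫ y, f y ∂μ} + ENNReal.ofReal c⁻¹ := by
  have hbad : μ.real {x | c * ∫ y, f y ∂μ < f x} ≤ c⁻¹ := by
    by_contra! hlarge
    have hpos : μ {x | c * ∫ y, f y ∂μ < f x} ≠ 0 := fun h0 => by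
      rw [measureReal_def, h0] at hlarge
      exact (inv_pos.2 hc).not_gt hlarge
    have hlt := setIntegral_gt_gt (mul_nonneg hc.le (integral_nonneg hf0)) hf.integrableOn hpos
    refine hlt.not_ge ((setIntegral_le_integral hf (Eventually.of_forall hf0)).trans ?_)
    rw [← mul_assoc]
    exact le_mul_of_one_le_left (integral_nonneg hf0) ((inv_le_iff_one_le_mul₀ hc).1 hlarge.le)
  calc μ univ = μ ({x | f x ≤ c * ∫ y, f y ∂μ} ∪ {x | c * ∫ y, f y ∂μ < f x}) := by
        congr
        ext x
        simp [le_or_gt]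
    _ ≤ μ {x | f x ≤ c * ∫ y, f y ∂μ} + μ {x | c * ∫ y, f y ∂μ < f x} := measure_union_le _ _
    _ ≤ μ {x | f x ≤ c * ∫ y, f y ∂μ} + ENNReal.ofReal c⁻¹ := by
        rw [← ofReal_measureReal (s := {x | c * ∫ y, f y ∂μ < f x})]
        gcongr

theorem norm_le_of_lagrangeError_le {𝕜 V : Type*} [RCLike 𝕜] [NormedAddCommGroup V]
    [NormedSpace 𝕜 V] {f : ℝ → V} {E : Set ℝ} (hE : MeasurableSet E)
    (hf : IntegrableOn (fun t => ‖f t‖) E) {α l ε : ℝ} (hl : 0 < l) (hEI : E ⊆ Icc α (α + l))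
    (hvol : ENNReal.ofReal (l / 2) ≤ volume E) (hε : 0 ≤ ε) (n : ℕ)
    (herr : ∀ t : ℕ → ℝ, Function.Injective t →
      (∀ i ∈ Finset.range (n + 1), t i ∈ Icc α (α + l)) → ∀ x ∈ Icc α (α + l),
        ‖lagrangeError 𝕜 (Finset.range (n + 1)) t x f‖ ≤
          (1 + lebesgueFunction (Finset.range (n + 1)) t x) * ε) {x : ℝ}
    (hx : x ∈ Icc α (α + l)) :
    ‖f x‖ ≤ 24 ^ (n + 1) * (4 / l * ∫ t in E, ‖f t‖) + 2 * 24 ^ (n + 1) * ε := by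
  have hgood : ENNReal.ofReal (l / 4) ≤ volume (E ∩ {t | ‖f t‖ ≤ 4 / l * ∫ t in E, ‖f t‖}) := by
    have : IsFiniteMeasure (volume.restrict E) :=
      ⟨by simpa using (measure_mono hEI).trans_lt measure_Icc_lt_top⟩
    have hmarkov := measure_univ_le_measure_le_integral_add (fun t => norm_nonneg (f t)) hf
      (c := 4 / l) (by positivity)
    rw [Measure.restrict_apply_univ, Measure.restrict_apply' hE, inter_comm, inv_div] at hmarkov
    rw [← ENNReal.add_le_add_iff_right (a := ENNReal.ofReal (l / 4)) ENNReal.ofReal_ne_top,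
      ← ENNReal.ofReal_add (by positivity) (by positivity)]
    convert! hvol.trans hmarkov using 2
    ring
  obtain ⟨t, htE, htinj, ht⟩ :=
    exists_nodes_lebesgueFunction_le hl (inter_subset_left.trans hEI) hgood n
  have hone : (1 : ℝ) ≤ 24 ^ (n + 1) := one_le_pow₀ (by norm_num)
  have hinterp := norm_le_norm_lagrangeError_add (𝕜 := 𝕜) (x := x) fun i hi => (htE i hi).2
  calc ‖f x‖ ≤ (1 + lebesgueFunction (Finset.range (n + 1)) t x) * ε +
        lebesgueFunction (Finset.range (n + 1)) t x * (4 / l * ∫ t in E, ‖f t‖) :=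
        hinterp.trans (add_le_add (herr t htinj (fun i hi => hEI (htE i hi).1) x hx) le_rfl)
    _ ≤ (2 * 24 ^ (n + 1)) * ε + 24 ^ (n + 1) * (4 / l * ∫ t in E, ‖f t‖) := by
        gcongr
        · linarith [ht x hx]
        · exact ht x hx
    _ = 24 ^ (n + 1) * (4 / l * ∫ t in E, ‖f t‖) + 2 * 24 ^ (n + 1) * ε := add_comm _ _

theorem exists_eventually_le_volume_inter_Icc {E : Set ℝ} (hE : MeasurableSet E)
    (hE0 : volume E ≠ 0) {η : ℝ} (hη0 : 0 < η) (hη1 : η ≤ 1) :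
    ∃ p ∈ E, ∀ᶠ r : ℝ in 𝓝[>] 0,
      ENNReal.ofReal (η * r / 2) ≤ volume (E ∩ Icc (p + r - η * r) (p + r)) := by
  have : (ae (volume.restrict E)).NeBot := by
    rwa [ae_neBot, Ne, Measure.restrict_eq_zero]
  obtain ⟨p, hpE, hp⟩ := ((ae_restrict_mem hE).and
    (IsUnifLocDoublingMeasure.ae_tendsto_measure_inter_div volume E (2 / η))).exists
  refine ⟨p, hpE, ?_⟩
  have hradius : Tendsto (fun r : ℝ => η * r / 2) (𝓝[>] 0) (𝓝[>] 0) := by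
    refine tendsto_nhdsWithin_iff.2 ⟨tendsto_nhdsWithin_of_tendsto_nhds ?_, ?_⟩
    · exact Continuous.tendsto' (by fun_prop) _ _ (by simp)
    · filter_upwards [self_mem_nhdsWithin] with r (hr : 0 < r)
      exact mem_Ioi.2 (by positivity)
  have hlim := hp (fun r => p + r - η * r / 2) (fun r => η * r / 2) hradius <| by
    filter_upwards [self_mem_nhdsWithin] with r (hr : 0 < r)
    rw [show 2 / η * (η * r / 2) = r by field_simp, Metric.mem_closedBall, Real.dist_eq, abs_le]
    constructor <;> nlinarith
  have hhalf : ENNReal.ofReal (1 / 2) < 1 := by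
    rw [ENNReal.ofReal_lt_one]
    norm_num
  filter_upwards [hlim.eventually (eventually_gt_nhds hhalf)] with r hr
  rw [Real.closedBall_eq_Icc, show p + r - η * r / 2 - η * r / 2 = p + r - η * r by ring,
    show p + r - η * r / 2 + η * r / 2 = p + r by ring, Real.volume_Icc,
    show p + r - (p + r - η * r) = η * r by ring] at hr
  have hmul := ENNReal.mul_le_of_le_div hr.le
  rwa [← ENNReal.ofReal_mul (by norm_num), one_div_mul_eq_div] at hmul

theorem sum_setIntegral_le_setIntegral {Ω ι : Type*} [MeasurableSpace Ω] {μ : Measure Ω}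
    {f : Ω → ℝ} (hf0 : ∀ x, 0 ≤ f x) {E : Set Ω} (hf : IntegrableOn f E μ) {F : ι → Set Ω}
    (hF : ∀ i, MeasurableSet (F i)) (hFE : ∀ i, F i ⊆ E) (s : Finset ι)
    (hdisj : (s : Set ι).PairwiseDisjoint F) : ∑ i ∈ s, ∫ x in F i, f x ∂μ ≤ ∫ x in E, f x ∂μ := by
  rw [← integral_biUnion_finset s (fun i _ => hF i) hdisj
    fun i _ => hf.mono_set (hFE i)]
  exact setIntegral_mono_set hf (Eventually.of_forall hf0)
    (iUnion₂_subset fun i _ => hFE i).eventuallyLE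

/-! ### The recursive observability inequality -/

theorem eventually_div_le_exp_one_div_rpow (C : ℝ) {k : ℝ} (hk : 0 < k) :
    ∀ᶠ L : ℝ in 𝓝[>] 0, C / L ≤ Real.exp (1 / L ^ k) := by
  have hinv : Tendsto (fun L : ℝ => (L ^ k)⁻¹) (𝓝[>] 0) atTop :=
    ((tendsto_rpow_atTop hk).comp tendsto_inv_nhdsGT_zero).congr' <| by
      filter_upwards [self_mem_nhdsWithin] with L (hL : 0 < L)
      exact Real.inv_rpow hL.le k
  have hlim := (tendsto_exp_div_rpow_atTop (1 / k)).comp hinv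
  filter_upwards [hlim.eventually_ge_atTop C, self_mem_nhdsWithin] with L hCL (hL : 0 < L)
  rwa [Function.comp_apply, ← Real.inv_rpow hL.le, ← Real.rpow_mul (by positivity),
    mul_one_div_cancel hk.ne', Real.rpow_one, div_inv_eq_mul, Real.inv_rpow hL.le, ← one_div,
    ← div_le_iff₀ hL] at hCL

theorem exists_pow_le_exp {w : ℝ} (hw : 0 ≤ w) :
    ∃ n : ℕ, (24 : ℝ) ^ n ≤ Real.exp (4 * w) ∧ (1 / 3 : ℝ) ^ (n + 1) ≤ Real.exp (-w) := by
  have hexp4 : (24 : ℝ) ≤ Real.exp 4 := by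
    rw [show (4 : ℝ) = (4 : ℕ) * 1 by norm_num, Real.exp_nat_mul]
    exact le_trans (by norm_num) (pow_le_pow_left₀ (by norm_num) Real.exp_one_gt_d9.le 4)
  have hexp1 : (1 / 3 : ℝ) ≤ Real.exp (-1) := by
    rw [Real.exp_neg, one_div]
    exact inv_anti₀ (Real.exp_pos 1) (Real.exp_one_lt_d9.le.trans (by norm_num))
  refine ⟨⌊w⌋₊, ?_, ?_⟩
  · calc (24 : ℝ) ^ ⌊w⌋₊ ≤ Real.exp 4 ^ ⌊w⌋₊ := by gcongr
      _ = Real.exp (⌊w⌋₊ * 4) := (Real.exp_nat_mul _ _).symm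
      _ ≤ Real.exp (4 * w) := by
          rw [mul_comm 4]
          gcongr
          exact Nat.floor_le hw
  · calc (1 / 3 : ℝ) ^ (⌊w⌋₊ + 1) ≤ Real.exp (-1) ^ (⌊w⌋₊ + 1) := by gcongr
      _ = Real.exp ((⌊w⌋₊ + 1 : ℕ) * -1) := (Real.exp_nat_mul _ _).symm
      _ ≤ Real.exp (-w) := by
          rw [mul_neg_one]
          gcongr
          exact_mod_cast (Nat.lt_floor_add_one w).le

theorem exists_exp_mul_pow_le_exp {D y : ℝ} (hD : 0 ≤ D) (hy : 0 ≤ y) :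
    ∃ n : ℕ, Real.exp (D * y) * 24 ^ n * Real.exp y ≤ Real.exp ((5 * D + 9) * y) ∧
      Real.exp (D * y) * (Real.exp y * (1 / 3) ^ (n + 1)) ≤ Real.exp (-y) := by
  obtain ⟨n, h24, h3⟩ := exists_pow_le_exp (w := (D + 2) * y) (by positivity)
  refine ⟨n, ?_, ?_⟩
  · calc Real.exp (D * y) * 24 ^ n * Real.exp y
        ≤ Real.exp (D * y) * Real.exp (4 * ((D + 2) * y)) * Real.exp y := by gcongr
      _ = Real.exp ((5 * D + 9) * y) := by
          rw [← Real.exp_add, ← Real.exp_add]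
          ring_nf
  · calc Real.exp (D * y) * (Real.exp y * (1 / 3) ^ (n + 1))
        ≤ Real.exp (D * y) * (Real.exp y * Real.exp (-((D + 2) * y))) := by gcongr
      _ = Real.exp (-y) := by
          rw [← Real.exp_add, ← Real.exp_add]
          ring_nf

/-- The observability inequality with a remainder: `S(L) u₀` is controlled by the observation on
any set of times filling half of `[L - κ L, L]`, up to an exponentially small multiple of the
initial state. -/
def RecursiveObservability {𝕜 : Type*} [RCLike 𝕜] {X : Type*} [NormedAddCommGroup X]
    [InnerProductSpace 𝕜 X] {U : Type*} [NormedAddCommGroup U] [InnerProductSpace 𝕜 U]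
    {A : X →ₗ.[𝕜] X} (S : ℝ → X →L[𝕜] X) (B : A.domain →ₗ[𝕜] U) (κ β k L : ℝ) : Prop :=
  ∀ (u₀ : A.domain) (E : Set ℝ), MeasurableSet E → E ⊆ Icc (L - κ * L) L →
    ENNReal.ofReal (κ * L / 2) ≤ volume E →
    ‖S L u₀‖ ≤ Real.exp (β / L ^ k) * (∫ t in E, ‖observe S B u₀ t‖) +
      Real.exp (-(1 / L ^ k)) * ‖(u₀ : X)‖

section Observation

variable {𝕜 : Type*} [RCLike 𝕜] {X : Type*} [NormedAddCommGroup X] [InnerProductSpace 𝕜 X]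
  {U : Type*} [NormedAddCommGroup U] [InnerProductSpace 𝕜 U] {A : X →ₗ.[𝕜] X}
  {S : ℝ → X →L[𝕜] X} {B : A.domain →ₗ[𝕜] U} {b : ℝ}

theorem RecursiveObservability.norm_map_add_le {κ β k L : ℝ}
    (hrec : RecursiveObservability S B κ β k L) (hS : IsC0Semigroup S)
    (hA : IsInfinitesimalGenerator A S) (hκ : κ ≤ 1) (hL : 0 ≤ L) (u₀ : A.domain) {a : ℝ}
    (ha : 0 ≤ a) {E : Set ℝ} (hE : MeasurableSet E)
    (hEI : E ⊆ Icc (a + L - κ * L) (a + L)) (hvol : ENNReal.ofReal (κ * L / 2) ≤ volume E) :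
    ‖S (a + L) u₀‖ ≤ Real.exp (β / L ^ k) * (∫ t in E, ‖observe S B u₀ t‖) +
      Real.exp (-(1 / L ^ k)) * ‖S a u₀‖ := by
  have hshift : (a + ·) ⁻¹' E ⊆ Icc (L - κ * L) L := fun t ht => by
    constructor <;> linarith [(hEI ht).1, (hEI ht).2]
  have hmeas : MeasurableSet ((a + ·) ⁻¹' E) := measurable_const_add a hE
  have hint : ∫ t in (a + ·) ⁻¹' E, ‖observe S B ⟨S a u₀, hS.map_mem_domain hA ha u₀⟩ t‖ =
      ∫ t in E, ‖observe S B u₀ t‖ := by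
    rw [← (measurePreserving_add_left volume a).setIntegral_preimage_emb
      (measurableEmbedding_addLeft a) (fun t => ‖observe S B u₀ t‖) E]
    refine setIntegral_congr_fun hmeas fun t ht => ?_
    have ht0 : 0 ≤ t := (sub_nonneg.2 (mul_le_of_le_one_left hL hκ)).trans (hshift ht).1
    rw [observe_map hS hA u₀ ha ht0]
  have h := hrec ⟨S a u₀, hS.map_mem_domain hA ha u₀⟩ _ hmeas hshift
    (by rwa [measure_preimage_add])
  rwa [hint, ← ContinuousLinearMap.comp_apply, ← hS.map_add L a hL ha, add_comm L] at h

namespace IsDiscExtension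

variable {Y : Type*} [NormedAddCommGroup Y] [NormedSpace ℂ Y] {j : X →+ Y}
  {T : ℂ → Y →L[ℂ] Y} {c δ M : ℝ}

theorem add_div_le (H : IsDiscExtension S j T c δ M) {L : ℝ} (hL : 0 < L) (hL1 : L ≤ 1) :
    M + M / (c * (L / 2)) ≤ 3 * M / c / L := by
  have hc := H.c_pos
  have hM := H.M_nonneg
  have hMle : M ≤ M / c / L :=
    (le_div_self hM hc H.c_lt_one.le).trans (le_div_self (by positivity) hL hL1)
  calc M + M / (c * (L / 2)) ≤ M / c / L + M / (c * (L / 2)) := by gcongr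
    _ = 3 * M / c / L := by
        field_simp
        norm_num

variable [CompleteSpace Y]

theorem norm_observe_le (H : IsDiscExtension S j T c δ M) (hS : IsC0Semigroup S)
    (hA : IsInfinitesimalGenerator A S) (hB : ObservationBoundedBy B b) {L : ℝ}
    (hL : L / 2 ∈ Ioo 0 δ) (hL1 : L ≤ 1) {E : Set ℝ} (hE : MeasurableSet E)
    (hEI : E ⊆ Icc (L - c / 144 * L) L) (hvol : ENNReal.ofReal (c / 144 * L / 2) ≤ volume E)
    (u₀ : A.domain) (n : ℕ) {x : ℝ} (hx : x ∈ Icc (L - c / 144 * L) L) :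
    ‖observe S B u₀ x‖ ≤ 24 ^ (n + 1) * (4 / (c / 144 * L) * ∫ t in E, ‖observe S B u₀ t‖) +
      12 * |b| * M ^ 2 / c / L * (1 / 3) ^ (n + 1) * ‖(u₀ : X)‖ := by
  have hc := H.c_pos
  have hc1 := H.c_lt_one
  have hM := H.M_nonneg
  have hL0 : 0 < L := by linarith [hL.1]
  have hI : Icc (L - c / 144 * L) L = Icc (L - c / 144 * L) (L - c / 144 * L + c / 144 * L) := by
    rw [sub_add_cancel]
  -- The nodes lie within `1 / 72` of the radius of the disc at `L / 2`, and `24 * (1 / 72) < 1`.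
  have hdist (t : ℝ) (ht : t ∈ Icc (L - c / 144 * L) L) :
      |t - (L / 2 + L / 2)| ≤ 1 / 72 * (c * (L / 2)) := by
    rw [add_halves, abs_le]
    constructor <;> linarith [ht.1, ht.2]
  have hint : IntegrableOn (fun t => ‖observe S B u₀ t‖) E :=
    H.integrableOn_norm_observe hS hA hB u₀ (hEI.trans (Icc_subset_Icc_left (by nlinarith)))
  set N : ℝ := |b| * (M + M / (c * (L / 2)))
  have : 0 ≤ N := by positivity
  have hN : N ≤ |b| * (3 * M / c / L) :=
    mul_le_mul_of_nonneg_left (H.add_div_le hL0 hL1) (abs_nonneg b)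
  refine (norm_le_of_lagrangeError_le (𝕜 := 𝕜)
    (ε := N * (2 * (M * ‖(u₀ : X)‖) * (1 / 72) ^ (n + 1))) hE hint (by positivity)
    (hEI.trans hI.subset) hvol (by positivity) n (fun t ht htI z hz => ?_)
    (hI ▸ hx)).trans (add_le_add le_rfl ?_)
  · rw [← hI] at hz htI
    have herr := H.norm_lagrangeError_observe_le hS hA hB hL (by norm_num) (by norm_num)
      ht.injOn (hdist z hz) (fun i hi => hdist _ (htI i hi)) u₀
    rw [Finset.card_range] at herr
    exact herr.trans_eq (by ring)
  · calc 2 * 24 ^ (n + 1) * (N * (2 * (M * ‖(u₀ : X)‖) * (1 / 72) ^ (n + 1)))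
        = 4 * N * M * (24 * (1 / 72)) ^ (n + 1) * ‖(u₀ : X)‖ := by
          rw [mul_pow]
          ring
      _ ≤ 4 * (|b| * (3 * M / c / L)) * M * (24 * (1 / 72)) ^ (n + 1) * ‖(u₀ : X)‖ := by gcongr
      _ = 12 * |b| * M ^ 2 / c / L * (1 / 3) ^ (n + 1) * ‖(u₀ : X)‖ := by
          rw [show (24 : ℝ) * (1 / 72) = 1 / 3 by norm_num]
          ring

theorem recursiveObservability (H : IsDiscExtension S j T c δ M) (hS : IsC0Semigroup S)
    (hA : IsInfinitesimalGenerator A S) (hB : ObservationBoundedBy B b) {d k L : ℝ} (hd : 0 ≤ d)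
    (hobs : IntervalObservability S B d k) (hL : L / 2 ∈ Ioo 0 δ) (hL1 : L ≤ 1)
    (hint : 96 / (c / 144) / L ≤ Real.exp (1 / L ^ k))
    (herr : 12 * |b| * M ^ 2 / c / L ≤ Real.exp (1 / L ^ k)) :
    RecursiveObservability S B (c / 144) (5 * (d / (c / 144) ^ k) + 9) k L := by
  intro u₀ E hE hEI hvol
  have hL0 : 0 < L := by linarith [hL.1]
  have hc := H.c_pos
  have hκL : c / 144 * L ≤ L := mul_le_of_le_one_left hL0.le (by linarith [H.c_lt_one])
  set κ := c / 144
  have hκ : 0 < κ := by positivity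
  set J := ∫ t in E, ‖observe S B u₀ t‖
  have : 0 ≤ J := integral_nonneg fun _ => norm_nonneg _
  obtain ⟨n, hmain, hremainder⟩ :=
    exists_exp_mul_pow_le_exp (D := d / κ ^ k) (y := 1 / L ^ k) (by positivity) (by positivity)
  have hstate := hobs.norm_le_exp_mul hS hA hd u₀ (a := L - κ * L) (l := κ * L)
    (sub_nonneg.2 hκL) (by positivity) (hκL.trans hL1) fun x hx =>
      H.norm_observe_le hS hA hB hL hL1 hE hEI hvol u₀ n (by rwa [sub_add_cancel] at hx)
  rw [sub_add_cancel, Real.mul_rpow hκ.le hL0.le, ← div_div, div_eq_mul_one_div _ (L ^ k)] at hstate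
  rw [div_eq_mul_one_div _ (L ^ k)]
  set D := d / κ ^ k
  set y := 1 / L ^ k
  calc ‖S L u₀‖
      ≤ Real.exp (D * y) * (24 ^ (n + 1) * (4 / (κ * L) * J) +
          12 * |b| * M ^ 2 / c / L * (1 / 3) ^ (n + 1) * ‖(u₀ : X)‖) := hstate
    _ = Real.exp (D * y) * 24 ^ n * (96 / κ / L) * J +
          Real.exp (D * y) * (12 * |b| * M ^ 2 / c / L * (1 / 3) ^ (n + 1)) * ‖(u₀ : X)‖ := by ring
    _ ≤ Real.exp (D * y) * 24 ^ n * Real.exp y * J +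
          Real.exp (D * y) * (Real.exp y * (1 / 3) ^ (n + 1)) * ‖(u₀ : X)‖ := by gcongr
    _ ≤ Real.exp ((5 * D + 9) * y) * J + Real.exp (-y) * ‖(u₀ : X)‖ := by gcongr

end IsDiscExtension

end Observation

theorem IsAnalyticSemigroup.exists_recursiveObservability {𝕜 : Type*} [RCLike 𝕜] {X : Type u}
    [NormedAddCommGroup X] [InnerProductSpace 𝕜 X] {S : ℝ → X →L[𝕜] X} {A : X →ₗ.[𝕜] X}
    (hSa : IsAnalyticSemigroup S) (hS : IsC0Semigroup S) (hA : IsInfinitesimalGenerator A S)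
    {d k : ℝ} (b : ℝ) (hd : 0 ≤ d) (hk : 0 < k) :
    ∃ κ β : ℝ, 0 < κ ∧ κ < 1 ∧ 0 < β ∧ ∀ᶠ L : ℝ in 𝓝[>] 0,
      ∀ (U : Type w) [NormedAddCommGroup U] [InnerProductSpace 𝕜 U] (B : A.domain →ₗ[𝕜] U),
        ObservationBoundedBy B b → IntervalObservability S B d k →
        RecursiveObservability S B κ β k L := by
  obtain ⟨Y, _, _, _, j, T, c, δ, M, H⟩ := hSa.exists_isDiscExtension
  have hc := H.c_pos
  refine ⟨c / 144, 5 * (d / (c / 144) ^ k) + 9, by positivity, by linarith [H.c_lt_one],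
    by positivity, ?_⟩
  have hsmall : ∀ᶠ L : ℝ in 𝓝[>] 0, L < min 1 δ :=
    nhdsWithin_le_nhds (eventually_lt_nhds (lt_min one_pos H.δ_pos))
  filter_upwards [self_mem_nhdsWithin, hsmall, eventually_div_le_exp_one_div_rpow _ hk,
    eventually_div_le_exp_one_div_rpow _ hk] with L (hL : 0 < L) hLsmall hint herr U _ _ B hB hobs
  obtain ⟨hL1, hLδ⟩ := lt_min_iff.1 hLsmall
  exact H.recursiveObservability hS hA hB hd hobs ⟨half_pos hL, (half_lt_self hL).trans hLδ⟩
    hL1.le hint herr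

/-! ### Telescoping towards a density point -/

theorem tendsto_atTop_of_mul_succ_eq {y : ℕ → ℝ} {β : ℝ} (hβ : 0 < β) (hy0 : 0 < y 0)
    (hy : ∀ m, β * y (m + 1) = (β + 1) * y m) : Tendsto y atTop atTop := by
  have hgeom (m : ℕ) : y 0 * ((β + 1) / β) ^ m = y m := by
    induction m with
    | zero => rw [pow_zero, mul_one]
    | succ m ih =>
      rw [pow_succ, ← mul_assoc, ih, mul_div_assoc', div_eq_iff hβ.ne', mul_comm, ← hy, mul_comm]
  have hratio : 1 < (β + 1) / β := (one_lt_div hβ).2 (lt_add_one β)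
  exact ((tendsto_pow_atTop_atTop_of_one_lt hratio).const_mul_atTop hy0).congr hgeom

theorem le_exp_mul_of_recursion {Φ J y : ℕ → ℝ} {β C I : ℝ} (hβ : 0 < β) (hy0 : 0 < y 0)
    (hy : ∀ m, β * y (m + 1) = (β + 1) * y m) (hΦ : ∀ m, Φ m ≤ C)
    (hJ : ∀ m, ∑ i ∈ Finset.range m, J i ≤ I)
    (hrec : ∀ m, Φ m ≤ Real.exp (β * y m) * J m + Real.exp (-y m) * Φ (m + 1)) :
    Φ 0 ≤ Real.exp (β * y 0) * I := by
  have hstep (m : ℕ) : Real.exp (-(β * y m)) * Φ m ≤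
      J m + Real.exp (-(β * y (m + 1))) * Φ (m + 1) := by
    calc Real.exp (-(β * y m)) * Φ m
        ≤ Real.exp (-(β * y m)) *
            (Real.exp (β * y m) * J m + Real.exp (-y m) * Φ (m + 1)) := by
          gcongr
          exact hrec m
      _ = J m + Real.exp (-(β * y (m + 1))) * Φ (m + 1) := by
          rw [mul_add, ← mul_assoc, ← mul_assoc, ← Real.exp_add, ← Real.exp_add, neg_add_cancel,
            Real.exp_zero, one_mul, hy]
          ring_nf
  have hsum (m : ℕ) : Real.exp (-(β * y 0)) * Φ 0 ≤
      ∑ i ∈ Finset.range m, J i + Real.exp (-(β * y m)) * Φ m := by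
    induction m with
    | zero => simp
    | succ m ih =>
      rw [Finset.sum_range_succ]
      linarith [hstep m]
  have hbound (m : ℕ) : Real.exp (-(β * y 0)) * Φ 0 ≤ I + Real.exp (-(β * y m)) * C :=
    (hsum m).trans (add_le_add (hJ m) (mul_le_mul_of_nonneg_left (hΦ m) (Real.exp_nonneg _)))
  have hdecay : Tendsto (fun m => Real.exp (-(β * y m))) atTop (𝓝 0) :=
    Real.tendsto_exp_neg_atTop_nhds_zero.comp
      ((tendsto_atTop_of_mul_succ_eq hβ hy0 hy).const_mul_atTop hβ)
  have hlim : Real.exp (-(β * y 0)) * Φ 0 ≤ I := by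
    refine ge_of_tendsto' (x := atTop) ?_ hbound
    simpa using (hdecay.mul_const C).const_add I
  rwa [Real.exp_neg, inv_mul_le_iff₀ (Real.exp_pos _)] at hlim

section Observation

variable {𝕜 : Type*} [RCLike 𝕜] {X : Type*} [NormedAddCommGroup X] [InnerProductSpace 𝕜 X]
  {U : Type*} [NormedAddCommGroup U] [InnerProductSpace 𝕜 U] {A : X →ₗ.[𝕜] X}
  {S : ℝ → X →L[𝕜] X} {B : A.domain →ₗ[𝕜] U} {κ β k q p : ℝ} {E : Set ℝ}

theorem RecursiveObservability.norm_map_add_le_setIntegral_inter_Ioc {s : ℝ}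
    (hrec : RecursiveObservability S B κ β k (s * (1 - q))) (hS : IsC0Semigroup S)
    (hA : IsInfinitesimalGenerator A S) (hκ : κ < 1) (hq0 : 0 ≤ q) (hq1 : q < 1) (hp : 0 ≤ p)
    (hs : 0 < s) (hE : MeasurableSet E) (u₀ : A.domain)
    (hint : IntegrableOn (fun t => ‖observe S B u₀ t‖) E)
    (hdens : ENNReal.ofReal (κ * (1 - q) * s / 2) ≤
      volume (E ∩ Icc (p + s - κ * (1 - q) * s) (p + s))) :
    ‖S (p + s) u₀‖ ≤ Real.exp (β * (1 / (s * (1 - q)) ^ k)) *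
        (∫ t in E ∩ Ioc (p + s * q) (p + s), ‖observe S B u₀ t‖) +
      Real.exp (-(1 / (s * (1 - q)) ^ k)) * ‖S (p + s * q) u₀‖ := by
  have hL : 0 < s * (1 - q) := mul_pos hs (sub_pos.2 hq1)
  have hend : p + s * q + s * (1 - q) = p + s := by ring
  have hκL : κ * (1 - q) * s = κ * (s * (1 - q)) := by ring
  have hsub : Icc (p + s - κ * (s * (1 - q))) (p + s) ⊆ Ioc (p + s * q) (p + s) := fun t ht =>
    ⟨by linarith [ht.1, mul_lt_of_lt_one_left hL hκ], ht.2⟩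
  rw [hκL] at hdens
  have hstep := hrec.norm_map_add_le hS hA hκ.le hL.le u₀ (a := p + s * q) (by positivity)
    (hE.inter measurableSet_Icc) (by rw [hend]; exact inter_subset_right) hdens
  rw [hend, ← mul_one_div] at hstep
  refine hstep.trans (add_le_add (mul_le_mul_of_nonneg_left ?_ (Real.exp_nonneg _)) le_rfl)
  exact setIntegral_mono_set (hint.mono_set inter_subset_left)
    (Eventually.of_forall fun _ => norm_nonneg _) (inter_subset_inter_right E hsub).eventuallyLE

theorem norm_map_add_le_exp_mul_setIntegral (hS : IsC0Semigroup S)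
    (hA : IsInfinitesimalGenerator A S) (hκ : κ < 1) (hβ : 0 < β) (hq0 : 0 < q) (hq1 : q < 1)
    (hq : q ^ k = β / (β + 1)) (hp : 0 ≤ p) {r : ℝ} (hr : 0 < r)
    (hrec : ∀ s ∈ Ioc 0 r, RecursiveObservability S B κ β k s) (hE : MeasurableSet E)
    (hdens : ∀ s ∈ Ioc 0 r, ENNReal.ofReal (κ * (1 - q) * s / 2) ≤
      volume (E ∩ Icc (p + s - κ * (1 - q) * s) (p + s)))
    (u₀ : A.domain) (hint : IntegrableOn (fun t => ‖observe S B u₀ t‖) E) {C : ℝ}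
    (hC : ∀ s ∈ Ioc 0 r, ‖S (p + s) u₀‖ ≤ C) :
    ‖S (p + r) u₀‖ ≤
      Real.exp (β * (1 / (r * (1 - q)) ^ k)) * ∫ t in E, ‖observe S B u₀ t‖ := by
  set s : ℕ → ℝ := fun m => r * q ^ m
  have hs0 : s 0 = r := by rw [show s 0 = r * q ^ 0 from rfl, pow_zero, mul_one]
  have hs_succ (m : ℕ) : s (m + 1) = s m * q := by simp only [s, pow_succ, mul_assoc]
  have hs (m : ℕ) : s m ∈ Ioc 0 r :=
    ⟨by positivity, mul_le_of_le_one_right hr.le (pow_le_one₀ hq0.le hq1.le)⟩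
  have hL (m : ℕ) : 0 < s m * (1 - q) := mul_pos (hs m).1 (sub_pos.2 hq1)
  have hanti : Antitone fun m => p + s m := antitone_nat_of_succ_le fun m => by
    linarith [hs_succ m, hL m]
  set F : ℕ → Set ℝ := fun m => E ∩ Ioc (p + s (m + 1)) (p + s m)
  have hdisj : Pairwise (Function.onFun Disjoint F) := fun m n hmn =>
    (hanti.pairwise_disjoint_on_Ioc_succ hmn).mono inter_subset_right inter_subset_right
  have hsum (m : ℕ) : ∑ i ∈ Finset.range m, ∫ t in F i, ‖observe S B u₀ t‖ ≤
      ∫ t in E, ‖observe S B u₀ t‖ :=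
    sum_setIntegral_le_setIntegral (fun _ => norm_nonneg _) hint
      (fun _ => hE.inter measurableSet_Ioc) (fun _ => inter_subset_left) _ (hdisj.set_pairwise _)
  rw [← hs0]
  refine le_exp_mul_of_recursion (Φ := fun m => ‖S (p + s m) u₀‖)
    (y := fun m => 1 / (s m * (1 - q)) ^ k) hβ (one_div_pos.2 (Real.rpow_pos_of_pos (hL 0) k))
    (fun m => ?_) (fun m => hC _ (hs m)) hsum fun m => ?_
  · have := Real.rpow_pos_of_pos (hL m) k
    simp only [hs_succ]
    rw [mul_right_comm, Real.mul_rpow (hL m).le hq0.le, hq]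
    field_simp
  · have hLr : s m * (1 - q) ∈ Ioc 0 r :=
      ⟨hL m, (mul_le_of_le_one_right (hs m).1.le (by linarith)).trans (hs m).2⟩
    simp only [F, hs_succ]
    exact (hrec _ hLr).norm_map_add_le_setIntegral_inter_Ioc hS hA hκ hq0.le hq1 hp (hs m).1 hE
      u₀ hint (hdens _ (hs m))

end Observation

theorem exists_rpow_eq_div_add_one {β k : ℝ} (hβ : 0 < β) (hk : 0 < k) :
    ∃ q : ℝ, 0 < q ∧ q < 1 ∧ q ^ k = β / (β + 1) := by
  have hlt : β / (β + 1) < 1 := (div_lt_one (by positivity)).2 (lt_add_one β)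
  refine ⟨(β / (β + 1)) ^ (1 / k), by positivity,
    Real.rpow_lt_one (by positivity) hlt (by positivity), ?_⟩
  rw [← Real.rpow_mul (by positivity), one_div_mul_cancel hk.ne', Real.rpow_one]

theorem IsAnalyticSemigroup.exists_norm_map_le_setIntegral {𝕜 : Type v} [RCLike 𝕜] {X : Type u}
    [NormedAddCommGroup X] [InnerProductSpace 𝕜 X] {S : ℝ → X →L[𝕜] X} {A : X →ₗ.[𝕜] X}
    (hSa : IsAnalyticSemigroup S) (hS : IsC0Semigroup S) (hA : IsInfinitesimalGenerator A S)
    {T : ℝ} {E : Set ℝ} (hE : MeasurableSet E) (hET : E ⊆ Ioo 0 T) (hE0 : volume E ≠ 0)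
    {d k : ℝ} (b : ℝ) (hd : 0 ≤ d) (hk : 0 < k) :
    ∃ t ∈ Ioo 0 T, ∃ C : ℝ, 0 < C ∧
      ∀ (U : Type w) [NormedAddCommGroup U] [InnerProductSpace 𝕜 U] (B : A.domain →ₗ[𝕜] U),
        ObservationBoundedBy B b → IntervalObservability S B d k →
        ∀ u₀ : A.domain, ‖S t u₀‖ ≤ C * ∫ t in E, ‖observe S B u₀ t‖ := by
  obtain ⟨Y, _, _, _, j, R, c, δ, M, H⟩ := hSa.exists_isDiscExtension
  obtain ⟨κ, β, hκ0, hκ1, hβ, hrec⟩ := hSa.exists_recursiveObservability.{u, w} hS hA b hd hk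
  obtain ⟨q, hq0, hq1, hq⟩ := exists_rpow_eq_div_add_one hβ hk
  obtain ⟨p, hpE, hdens⟩ := exists_eventually_le_volume_inter_Icc hE hE0
    (η := κ * (1 - q)) (mul_pos hκ0 (sub_pos.2 hq1)) (by nlinarith)
  obtain ⟨hp0, hpT⟩ := hET hpE
  have hsmall : ∀ᶠ s : ℝ in 𝓝[>] 0, s < min δ (T - p) :=
    nhdsWithin_le_nhds (eventually_lt_nhds (lt_min H.δ_pos (sub_pos.2 hpT)))
  obtain ⟨r, hr : 0 < r, hIoc⟩ :=
    mem_nhdsGT_iff_exists_Ioc_subset.1 (hrec.and (hdens.and hsmall))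
  have hlt (s : ℝ) (hs : s ∈ Ioc 0 r) : s < δ ∧ s < T - p := lt_min_iff.1 (hIoc hs).2.2
  refine ⟨p + r, ⟨add_pos hp0 hr, by linarith [hlt r ⟨hr, le_rfl⟩]⟩, _, Real.exp_pos _,
    fun U _ _ B hB hobs u₀ => norm_map_add_le_exp_mul_setIntegral hS hA hκ1 hβ hq0 hq1 hq hp0.le hr
      (fun s hs => (hIoc hs).1 U B hB hobs) hE (fun s hs => (hIoc hs).2.1) u₀
      (H.integrableOn_norm_observe hS hA hB u₀ (hET.trans Ioo_subset_Icc_self))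
      (C := M * ‖S p (u₀ : X)‖) fun s hs => ?_⟩
  rw [add_comm, hS.map_add s p hs.1.le hp0.le]
  exact H.norm_semigroup_le ⟨hs.1, (hlt s hs).1⟩ _

theorem theorem1p1_general {𝕜 : Type v} [RCLike 𝕜]
    {X : Type u} [NormedAddCommGroup X] [InnerProductSpace 𝕜 X]
    (S : ℝ → X →L[𝕜] X) (A : X →ₗ.[𝕜] X)
    (hS : IsC0Semigroup S) (hA : IsInfinitesimalGenerator A S) (hSa : IsAnalyticSemigroup S)
    (T : ℝ) (E : Set ℝ) (hE : NullMeasurableSet E volume)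
    (hET : E ⊆ Ioo 0 T) (hE0 : 0 < volume E) (d k b : ℝ) :
    ∃ C : ℝ, 0 < C ∧
      ∀ (U : Type w) [NormedAddCommGroup U] [InnerProductSpace 𝕜 U] (B : A.domain →ₗ[𝕜] U),
        ObservationBoundedBy B b →
        IntervalObservability S B d k →
        ∀ u₀ : A.domain, ‖S T u₀‖ ≤ C * ∫ t in E, ‖observe S B u₀ t‖ := by
  obtain ⟨E', hE'E, hE', hae⟩ := hE.exists_measurable_subset_ae_eq
  obtain ⟨t, ⟨ht0, htT⟩, C, hC, hobs⟩ := hSa.exists_norm_map_le_setIntegral.{u, v, w} hS hA hE'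
    (hE'E.trans hET) (by rwa [measure_congr hae, ← pos_iff_ne_zero]) b (le_max_right d 0)
    (one_pos.trans_le (le_max_right k 1))
  refine ⟨(‖S (T - t)‖ + 1) * C, by positivity, fun U _ _ B hB hint u₀ => ?_⟩
  have ht : ‖S t u₀‖ ≤ C * ∫ t in E, ‖observe S B u₀ t‖ := by
    rw [← setIntegral_congr_set hae]
    exact hobs U B hB (hint.mono (le_max_left d 0) (le_max_right d 0) (le_max_left k 1)) u₀
  calc ‖S T u₀‖ = ‖S (T - t) (S t u₀)‖ := by
        rw [← ContinuousLinearMap.comp_apply, ← hS.map_add _ _ (sub_nonneg.2 htT.le) ht0.le,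
          sub_add_cancel]
    _ ≤ ‖S (T - t)‖ * ‖S t u₀‖ := (S (T - t)).le_opNorm _
    _ ≤ (‖S (T - t)‖ + 1) * (C * ∫ t in E, ‖observe S B u₀ t‖) := by
        gcongr
        exact (lt_add_one _).le
    _ = (‖S (T - t)‖ + 1) * C * ∫ t in E, ‖observe S B u₀ t‖ := (mul_assoc _ _ _).symm

theorem theorem1p1 {𝕜 : Type v} [RCLike 𝕜]
    {X : Type u} [NormedAddCommGroup X] [InnerProductSpace 𝕜 X] [CompleteSpace X]
    (S : ℝ → X →L[𝕜] X) (A : X →ₗ.[𝕜] X)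
    (hS : IsC0Semigroup S) (hA : IsInfinitesimalGenerator A S) (hSa : IsAnalyticSemigroup S)
    (T : ℝ) (hT : 0 < T) (E : Set ℝ) (hE : NullMeasurableSet E volume)
    (hET : E ⊆ Ioo 0 T) (hE0 : 0 < volume E)
    (d k b : ℝ) (hd : 0 < d) (hk : 0 < k) :
    ∃ C : ℝ, 0 < C ∧
      ∀ (U : Type w) [NormedAddCommGroup U] [InnerProductSpace 𝕜 U] [CompleteSpace U]
        (B : A.domain →ₗ[𝕜] U),
        ObservationBoundedBy B b →
        IsAdmissibleObservation S B →
        IntervalObservability S B d k →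
        ∀ u₀ : A.domain, ‖S T u₀‖ ≤ C * ∫ t in E, ‖observe S B u₀ t‖ := by
  obtain ⟨C, hC, h⟩ := theorem1p1_general.{u, v, w} S A hS hA hSa T E hE hET hE0 d k b
  exact ⟨C, hC, fun U _ _ _ B hB _ hobs => h U B hB hobs⟩
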